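/- **Setting.** $n\ge 1$ electric vehicles are charged over $T$ time steps, in a grid with $m\ge 1$ households, where $n/m=\gamma$. User $i$ has maximal rates $\bar r_i\in\mathbb R^T$ with $\bar r_i\succeq 0$ and an energy demand $E_i$ with $0\le E_i\le \mathbf 1^T\bar r_i$; the set of admissible profiles is $\mathcal C_i=\mathcal C(\bar r_i,E_i)=\{r\in\mathbb R^T: 0\preceq r\preceq \bar r_i,\ \mathbf 1^T r=E_i\}$. For a base load $d\in\mathbb R^T$ let $U(x)=\tfrac12\|d+x/m\|^2$, and let $U^*$ be the minimum of $U(\sum_i r_i)$ over $r_i\in\mathcal C_i$, $i=1,\dots,n$. Write $\Pi_{\mathcal C}$ for the Euclidean projection onto $\mathcal C$. The gradient $\nabla U$ is Lipschitz with constant $L=1/m^2$. Put $$\rho=\max_{r_i\in\mathcal C_i}\Big(\sum_i\|r_i\|^2\Big)^{1/2},\qquad G=\max_{r_i\in\mathcal C_i}\Big\|\nabla U\Big(\sum_i r_i\Big)\Big\|,$$ and for given $\delta r,\delta E$ let $$\Delta=\sup\big\{\|\Pi_{\mathcal C(\bar r,E)}(r)-\Pi_{\mathcal C(\bar r',E')}(r)\|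 : r\in\mathbb R^T,\ \|\bar r-\bar r'\|_1\le\delta r,\ |E-E'|\le\delta E\big\},$$ where $(\bar r,E)$ and $(\bar r',E')$ range over all feasible specifications ($\bar r\succeq0$, $0\le E\le\mathbf 1^T\bar r$). Assume $\Delta>0$. **Algorithm.** Given $\epsilon>0$, $\eta\ge1$, a number $K\ge1$ of iterations, step sizes $\alpha_k=c/\sqrt k$, and an arbitrary initial point $\{r_i^{(1)}\}_{i=1}^n$ in $\mathbb R^T$, put $\hat r_i^{(1)}=r_i^{(1)}$ and $\theta_k=(\eta+1)/(\eta+k)$. For $k=1,\dots,K$: let $w_1=0$, and for $k\ge2$ draw $w_k\in\mathbb R^T$ independently with density proportional to $\exp\!\big(-\tfrac{2\epsilon\|w\|}{K(K-1)L\Delta}\big)$; let $\hat p^{(k)}=\nabla U(\sum_i r_i^{(k)})+w_k$; and for each $i$ let $r_i^{(k+1)}=\Pi_{\mathcal C_i}(r_i^{(k)}-\alpha_k\hat p^{(k)})$ and $\hat r_i^{(k+1)}=(1-\theta_k)\hat r_i^{(k)}+\theta_k r_i^{(k+1)}$. The output is $\{\hat r_i^{(K+1)}\}_{i=1}^n$.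 **Parameters.** $K\ge 1$ is any integer with $|K-K^*|\le 1$, where $K^*=\big(\sqrt2\,G\epsilon/(3TL\Delta)\big)^{1/2}$, and $c=\rho/\widehat G$ with $\widehat G=\sqrt n\,\big(G+\sqrt2\,TK^2L\Delta/(2\epsilon)\big)$. **Statement.** For all $\gamma>0$, $R$ and $D$ there is a constant $B>0$, depending only on $\gamma,R,D$, such that in every instance as above with $n/m=\gamma$, with $\|d\|\le D$, and with $\|r\|\le R$ for all $r\in\mathcal C_i$ and all $i$, the suboptimality $U\big(\sum_i\hat r_i^{(K+1)}\big)-U^*$ is integrable and $$\mathbb E\Big[U\Big(\sum_{i=1}^n\hat r_i^{(K+1)}\Big)-U^*\Big]\ \le\ B\,\eta\,T^{1/4}\Big(\frac{\Delta}{n\epsilon}\Big)^{1/4}.$$ -/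

import Mathlib

open MeasureTheory ProbabilityTheory

namespace PrivateDCO

noncomputable section

/-- The Euclidean space of charging profiles over `T` time steps. -/
abbrev Vec (T : ℕ) : Type := EuclideanSpace ℝ (Fin T)

/-- Euclidean projection of `x` onto `C`: the point of `C` closest to `x`
(unique for a nonempty closed convex `C`). -/
def proj {T : ℕ} (C : Set (Vec T)) (x : Vec T) : Vec T :=
  Classical.epsilon fun y => y ∈ C ∧ ∀ z ∈ C, ‖y - x‖ ≤ ‖z - x‖

/-! ### The optimization problem `min U (∑ i, r i)` subject to `r i ∈ C i` -/

/-- The feasible allocations. -/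
def feasible {n T : ℕ} (C : Fin n → Set (Vec T)) : Set (Fin n → Vec T) :=
  {r | ∀ i, r i ∈ C i}

/-- The optimal value `U*`. -/
def optValue {n T : ℕ} (U : Vec T → ℝ) (C : Fin n → Set (Vec T)) : ℝ :=
  sInf ((fun r : Fin n → Vec T => U (∑ i, r i)) '' feasible C)

/-- `ρ`, the largest Euclidean norm of a feasible allocation `(r_1, …, r_n)`. -/
def maxNorm {n T : ℕ} (C : Fin n → Set (Vec T)) : ℝ :=
  sSup ((fun r : Fin n → Vec T => √(∑ i, ‖r i‖ ^ 2)) '' feasible C)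

/-- `G`, the largest norm of the gradient of `U` at the sum of a feasible allocation. -/
def maxGrad {n T : ℕ} (U : Vec T → ℝ) (C : Fin n → Set (Vec T)) : ℝ :=
  sSup ((fun r : Fin n → Vec T => ‖gradient U (∑ i, r i)‖) '' feasible C)

/-! ### The private distributed projected gradient method -/

/-- Iterates of the method with step sizes `α`, noise vectors `w` and initial point `r₁`;
`iterate U C α w r₁ k` is `r^{(k+1)}`, so that
`r_i^{(k+2)} = Π_{C_i} (r_i^{(k+1)} - α_{k+1} (∇U (∑ j, r_j^{(k+1)}) + w_{k+1}))`. -/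
def iterate {n T : ℕ} (U : Vec T → ℝ) (C : Fin n → Set (Vec T)) (α : ℕ → ℝ)
    (w : ℕ → Vec T) (r₁ : Fin n → Vec T) : ℕ → Fin n → Vec T
  | 0 => r₁
  | k + 1 => fun i =>
      proj (C i) (iterate U C α w r₁ k i
        - α (k + 1) • (gradient U (∑ j, iterate U C α w r₁ k j) + w (k + 1)))

/-- The averaging weights `θ_k = (η + 1) / (η + k)`. -/
def weight (η : ℝ) (k : ℕ) : ℝ := (η + 1) / (η + k)

/-- The averaged iterates; `averaged U C α η w r₁ k` is `r̂^{(k+1)}`, so that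
`r̂^{(k+2)} = (1 - θ_{k+1}) r̂^{(k+1)} + θ_{k+1} r^{(k+2)}`. The output after `K` iterations
is `averaged U C α η w r₁ K`. -/
def averaged {n T : ℕ} (U : Vec T → ℝ) (C : Fin n → Set (Vec T)) (α : ℕ → ℝ) (η : ℝ)
    (w : ℕ → Vec T) (r₁ : Fin n → Vec T) : ℕ → Fin n → Vec T
  | 0 => r₁
  | k + 1 => fun i =>
      (1 - weight η (k + 1)) • averaged U C α η w r₁ k i
        + weight η (k + 1) • iterate U C α w r₁ (k + 1) i

/-- The probability distribution on `ℝ^T` with density proportional to `exp (-a ‖x‖)`. -/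
def noiseLaw (T : ℕ) (a : ℝ) : Measure (Vec T) :=
  (∫⁻ x : Vec T, ENNReal.ofReal (Real.exp (-(a * ‖x‖))))⁻¹ •
    (volume : Measure (Vec T)).withDensity fun x => ENNReal.ofReal (Real.exp (-(a * ‖x‖)))

/-- `w_1, …, w_K` are noise vectors as drawn by the method run for `K` iterations: `w_1 = 0`,
and `w_2, …, w_K` are independent with density proportional to
`exp (-2 ε ‖x‖ / (K (K - 1) L Δ))`. -/
structure IsNoise {Ω : Type*} [MeasurableSpace Ω] (P : Measure Ω) {T : ℕ} (K : ℕ) (L Δ ε : ℝ)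
    (w : ℕ → Ω → Vec T) : Prop where
  first : ∀ ω, w 1 ω = 0
  law : ∀ k : ℕ, 2 ≤ k → k ≤ K →
    HasLaw (w k) (noiseLaw T (2 * ε / ((K : ℝ) * ((K : ℝ) - 1) * L * Δ))) P
  indep : iIndepFun (fun (k : Set.Icc 2 K) => w (k : ℕ)) P

/-! ### Electric vehicle charging -/

/-- The admissible charging profiles of a user with maximal rates `rbar` and energy demand `E`. -/
def chargingSet {T : ℕ} (rbar : Vec T) (E : ℝ) : Set (Vec T) :=
  {r | (∀ t, 0 ≤ r t ∧ r t ≤ rbar t) ∧ ∑ t, r t = E}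

/-- `(rbar, E)` is a feasible charging specification. -/
def IsSpec {T : ℕ} (rbar : Vec T) (E : ℝ) : Prop :=
  (∀ t, 0 ≤ rbar t) ∧ 0 ≤ E ∧ E ≤ ∑ t, rbar t

/-- `Δ`, the global `ℓ₂`-sensitivity of the projection onto the charging set with respect to
changes of at most `δr` (in `ℓ₁`-norm) of `rbar` and at most `δE` of `E`. -/
def projSensitivity (T : ℕ) (δr δE : ℝ) : ℝ :=
  sSup {s : ℝ | ∃ (rbar rbar' : Vec T) (E E' : ℝ) (r : Vec T),
    IsSpec rbar E ∧ IsSpec rbar' E' ∧ ∑ t, |rbar t - rbar' t| ≤ δr ∧ |E - E'| ≤ δE ∧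
    s = ‖proj (chargingSet rbar E) r - proj (chargingSet rbar' E') r‖}

/-- The load variance cost `U x = ½ ‖d + x / m‖²`. -/
def evCost {T : ℕ} (d : Vec T) (m : ℕ) (x : Vec T) : ℝ :=
  1 / 2 * ‖d + (1 / (m : ℝ)) • x‖ ^ 2

/-! ### The choice of the parameters -/

/-- The (real) number of iterations `(√2 G ε / (3 T L Δ))^{1/2}` minimizing the bound
`G / √K + √2 T K^{3/2} L Δ / (2 ε)`. -/
def optIter (T : ℕ) (G L Δ ε : ℝ) : ℝ := √(√2 * G * ε / (3 * T * L * Δ))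

/-- `Ĝ = √n (G + √2 T K² L Δ / (2 ε))`, which bounds the root mean square of the norm of the noisy
gradients with respect to `(r_1, …, r_n)`. -/
def noisyGrad (n T K : ℕ) (G L Δ ε : ℝ) : ℝ :=
  √n * (G + √2 * T * K ^ 2 * L * Δ / (2 * ε))

end

end PrivateDCO

open scoped RealInnerProductSpace

namespace PrivateDCO

/-! ### Euclidean projection -/

/-! The method is projected stochastic gradient descent on the product of the sets `C i`, the same
noise vector entering all `n` blocks. For a fixed feasible competitor `z`, nonexpansiveness of the
projections and convexity of `U` bound the suboptimality of an iterate by the decrease of the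
squared distance to `z`, plus `a² n ‖g + w‖²`, plus a term linear in the noise
(`projected_step_le`). The linear term has mean zero, because each noise vector is centred and
independent of the iterate it perturbs (`IsNoise.indepFun_iterate`, `expected_step_le`). The second
moment of the noise is a ratio of Gamma integrals.

The weights `θ_k` turn these one-step inequalities into a bound of order `η ρ Ĝ / √K` for the
averaged point, without a logarithm (`averaging_bound`, `expected_averaged_sub_le_noisyGrad`). Since
`θ_1 = 1`, the arbitrary and possibly infeasible initial point is forgotten, so every distance is at
most `2ρ` and every gradient at most `G`.

With `q = T L Δ / ε` this bound is a multiple of `√n ρ (G / √K + √2 K^{3/2} q / 2)`. For `K` near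
its minimizer it has order `√n ρ G^{3/4} q^{1/4}`; when the minimizer is below 2, rounding is too
coarse and the a priori bound `2 √n ρ G` takes over (`le_of_optimal_iterations`). Finally `√n ρ ≤ n
|R|`, `G = O(1/m)`, `L = 1/m²` and `n = γ m` yield the stated rate. -/

lemma proj_spec {T : ℕ} {C : Set (Vec T)} (hne : C.Nonempty) (hcl : IsClosed C)
    (hcv : Convex ℝ C) (x : Vec T) :
    proj C x ∈ C ∧ ∀ z ∈ C, ‖proj C x - x‖ ≤ ‖z - x‖ := by
  unfold proj
  apply Classical.epsilon_spec (p := fun y => y ∈ C ∧ ∀ z ∈ C, ‖y - x‖ ≤ ‖z - x‖)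
  obtain ⟨v, hv, h⟩ := exists_norm_eq_iInf_of_complete_convex hne hcl.isComplete hcv x
  refine ⟨v, hv, fun z hz => ?_⟩
  rw [norm_sub_rev, h, norm_sub_rev z]
  exact ciInf_le ⟨0, Set.forall_mem_range.2 fun _ => norm_nonneg _⟩ (⟨z, hz⟩ : C)

lemma inner_sub_proj_le {T : ℕ} {C : Set (Vec T)} (hne : C.Nonempty) (hcl : IsClosed C)
    (hcv : Convex ℝ C) (x : Vec T) {z : Vec T} (hz : z ∈ C) :
    ⟪x - proj C x, z - proj C x⟫ ≤ 0 := by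
  obtain ⟨h1, h2⟩ := proj_spec hne hcl hcv x
  refine (norm_eq_iInf_iff_real_inner_le_zero hcv h1).1 ?_ z hz
  have : Nonempty C := ⟨⟨_, h1⟩⟩
  refine le_antisymm (le_ciInf fun w => ?_)
    (ciInf_le ⟨0, Set.forall_mem_range.2 fun _ => norm_nonneg _⟩ (⟨_, h1⟩ : C))
  rw [norm_sub_rev, norm_sub_rev x]
  exact h2 w w.2

/-- Adding the variational inequalities at the two projections gives firm nonexpansiveness `‖p - q‖²
≤ ⟪x - y, p - q⟫`; Cauchy–Schwarz finishes. -/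
lemma norm_proj_sub_proj_le {T : ℕ} {C : Set (Vec T)} (hne : C.Nonempty) (hcl : IsClosed C)
    (hcv : Convex ℝ C) (x y : Vec T) : ‖proj C x - proj C y‖ ≤ ‖x - y‖ := by
  have h1 := inner_sub_proj_le hne hcl hcv x (proj_spec hne hcl hcv y).1
  have h2 := inner_sub_proj_le hne hcl hcv y (proj_spec hne hcl hcv x).1
  set p := proj C x
  set q := proj C y
  have h3 : ‖p - q‖ ^ 2 ≤ ⟪x - y, p - q⟫ := by
    have e : ⟪x - y, p - q⟫ = ‖p - q‖ ^ 2 - ⟪x - p, q - p⟫ - ⟪y - q, p - q⟫ := by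
      rw [← real_inner_self_eq_norm_sq, ← neg_sub p q, inner_neg_right, sub_neg_eq_add,
        ← inner_add_left, ← inner_sub_left]
      congr 1
      abel
    linarith
  have h4 := real_inner_le_norm (x - y) (p - q)
  rcases (norm_nonneg (p - q)).eq_or_lt with h | h
  · rw [← h]; exact norm_nonneg _
  · nlinarith

lemma proj_eq_self {T : ℕ} {C : Set (Vec T)} {z : Vec T} (hz : z ∈ C) : proj C z = z := by
  have h := Classical.epsilon_spec (p := fun y => y ∈ C ∧ ∀ w ∈ C, ‖y - z‖ ≤ ‖w - z‖)
    ⟨z, hz, fun w _ => by simp⟩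
  have h2 : ‖proj C z - z‖ ≤ 0 := (h.2 z hz).trans_eq (by simp)
  exact sub_eq_zero.1 (norm_le_zero_iff.1 h2)

lemma norm_proj_sub_le {T : ℕ} {C : Set (Vec T)} (hcl : IsClosed C)
    (hcv : Convex ℝ C) (x : Vec T) {z : Vec T} (hz : z ∈ C) : ‖proj C x - z‖ ≤ ‖x - z‖ := by
  simpa [proj_eq_self hz] using norm_proj_sub_proj_le ⟨z, hz⟩ hcl hcv x z

lemma continuous_proj {T : ℕ} {C : Set (Vec T)} (hne : C.Nonempty) (hcl : IsClosed C)
    (hcv : Convex ℝ C) : Continuous (proj C) := by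
  refine (LipschitzWith.of_dist_le_mul (K := 1) fun x y => ?_).continuous
  simpa [dist_eq_norm] using norm_proj_sub_proj_le hne hcl hcv x y

/-! ### Charging sets -/

lemma chargingSet_nonempty {T : ℕ} {rbar : Vec T} {E : ℝ} (h : IsSpec rbar E) :
    (chargingSet rbar E).Nonempty := by
  obtain ⟨h0, hE0, hE⟩ := h
  rcases (hE0.trans hE).eq_or_lt with hs | hs
  · refine ⟨0, fun t => ⟨by simp, by simpa using h0 t⟩, ?_⟩
    simp only [PiLp.zero_apply, Finset.sum_const_zero]
    linarith
  · refine ⟨(E / ∑ t, rbar t) • rbar, fun t => ⟨?_, ?_⟩, ?_⟩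
    · exact mul_nonneg (div_nonneg hE0 hs.le) (h0 t)
    · exact mul_le_of_le_one_left (h0 t) ((div_le_one hs).2 hE)
    · simp only [PiLp.smul_apply, smul_eq_mul, ← Finset.mul_sum]
      exact div_mul_cancel₀ _ hs.ne'

lemma isClosed_chargingSet {T : ℕ} (rbar : Vec T) (E : ℝ) : IsClosed (chargingSet rbar E) := by
  have : chargingSet rbar E =
      (⋂ t, {r : Vec T | 0 ≤ r t} ∩ {r : Vec T | r t ≤ rbar t}) ∩ {r : Vec T | ∑ t, r t = E} := by
    ext r
    simp [chargingSet]
  rw [this]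
  refine (isClosed_iInter fun t => ?_).inter ?_
  · exact (isClosed_le (by fun_prop) (by fun_prop)).inter (isClosed_le (by fun_prop) (by fun_prop))
  · exact isClosed_eq (by fun_prop) (by fun_prop)

lemma convex_chargingSet {T : ℕ} (rbar : Vec T) (E : ℝ) : Convex ℝ (chargingSet rbar E) := by
  rintro x ⟨hx, hxE⟩ y ⟨hy, hyE⟩ a b ha hb hab
  refine ⟨fun t => ⟨?_, ?_⟩, ?_⟩
  · simp only [PiLp.add_apply, PiLp.smul_apply, smul_eq_mul]
    have := mul_nonneg ha (hx t).1
    have := mul_nonneg hb (hy t).1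
    linarith
  · simp only [PiLp.add_apply, PiLp.smul_apply, smul_eq_mul]
    calc a * x t + b * y t ≤ a * rbar t + b * rbar t :=
          add_le_add (mul_le_mul_of_nonneg_left (hx t).2 ha)
            (mul_le_mul_of_nonneg_left (hy t).2 hb)
      _ = rbar t := by rw [← add_mul, hab, one_mul]
  · simp only [PiLp.add_apply, PiLp.smul_apply, smul_eq_mul, Finset.sum_add_distrib,
      ← Finset.mul_sum, hxE, hyE, ← add_mul, hab, one_mul]

/-! ### The load variance cost -/

lemma gradient_evCost {T : ℕ} (d : Vec T) (m : ℕ) (x : Vec T) :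
    gradient (evCost d m) x = (1 / (m : ℝ)) • (d + (1 / (m : ℝ)) • x) := by
  apply HasGradientAt.gradient
  rw [hasGradientAt_iff_hasFDerivAt]
  have h1 : HasFDerivAt (fun x : Vec T => d + (1 / (m : ℝ)) • x)
      ((1 / (m : ℝ)) • ContinuousLinearMap.id ℝ (Vec T)) x :=
    ((hasFDerivAt_id x).const_smul (1 / (m : ℝ))).const_add d
  refine (h1.norm_sq.const_mul (1 / 2 : ℝ)).congr_fderiv ?_
  ext v
  simp

lemma continuous_evCost {T : ℕ} (d : Vec T) (m : ℕ) : Continuous (evCost d m) := by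
  unfold evCost
  fun_prop

lemma continuous_gradient_evCost {T : ℕ} (d : Vec T) (m : ℕ) :
    Continuous (gradient (evCost d m)) := by
  rw [show gradient (evCost d m) = _ from funext (gradient_evCost d m)]
  fun_prop

/-- For a half squared norm, `½‖a‖² - ½‖b‖² = ⟪a, a - b⟫ - ½‖a - b‖²`, and the last term is dropped.
-/
lemma evCost_sub_le {T : ℕ} (d : Vec T) (m : ℕ) (x z : Vec T) :
    evCost d m x - evCost d m z ≤ ⟪gradient (evCost d m) x, x - z⟫ := by
  rw [gradient_evCost, real_inner_smul_left, ← real_inner_smul_right]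
  unfold evCost
  set a := d + (1 / (m : ℝ)) • x
  set b := d + (1 / (m : ℝ)) • z
  have : (1 / (m : ℝ)) • (x - z) = a - b := by simp only [a, b, smul_sub]; abel
  rw [this]
  have h1 := norm_sub_sq_real a b
  have h2 : ⟪a, a - b⟫ = ‖a‖ ^ 2 - ⟪a, b⟫ := by rw [inner_sub_right, real_inner_self_eq_norm_sq]
  nlinarith [sq_nonneg ‖a - b‖]

lemma convexOn_evCost {T : ℕ} (d : Vec T) (m : ℕ) : ConvexOn ℝ Set.univ (evCost d m) := by
  refine ⟨convex_univ, fun x _ y _ a b ha hb hab => ?_⟩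
  set p := a • x + b • y
  have hx := evCost_sub_le d m p x
  have hy := evCost_sub_le d m p y
  have : a * ⟪gradient (evCost d m) p, p - x⟫ + b * ⟪gradient (evCost d m) p, p - y⟫ = 0 := by
    rw [← real_inner_smul_right, ← real_inner_smul_right, ← inner_add_right]
    have : a • (p - x) + b • (p - y) = 0 := by
      rw [smul_sub, smul_sub, sub_add_sub_comm, ← add_smul, hab, one_smul, sub_self]
    rw [this, inner_zero_right]
  have h1 := mul_le_mul_of_nonneg_left hx ha
  have h2 := mul_le_mul_of_nonneg_left hy hb
  have h3 : a * evCost d m p + b * evCost d m p = evCost d m p := by rw [← add_mul, hab, one_mul]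
  simp only [smul_eq_mul]
  linarith

lemma norm_gradient_evCost_le {T : ℕ} (d : Vec T) (m : ℕ) (x : Vec T) :
    ‖gradient (evCost d m) x‖ ≤ 1 / m * (‖d‖ + 1 / m * ‖x‖) := by
  rw [gradient_evCost, norm_smul, Real.norm_of_nonneg (by positivity)]
  gcongr
  refine (norm_add_le _ _).trans ?_
  rw [norm_smul, Real.norm_of_nonneg (by positivity)]

/-! ### Feasible allocations -/

lemma norm_sum_le_sqrt_mul_sqrt {n T : ℕ} (x : Fin n → Vec T) :
    ‖∑ i, x i‖ ≤ √n * √(∑ i, ‖x i‖ ^ 2) := by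
  refine (norm_sum_le _ _).trans ?_
  rw [← Real.sqrt_mul (Nat.cast_nonneg _)]
  apply Real.le_sqrt_of_sq_le
  simpa using sq_sum_le_card_mul_sum_sq (s := Finset.univ) (f := fun i => ‖x i‖)

lemma bddAbove_image_sqrt_sum {n T : ℕ} {C : Fin n → Set (Vec T)} {R : ℝ}
    (hR : ∀ i, ∀ r ∈ C i, ‖r‖ ≤ R) :
    √n * |R| ∈ upperBounds ((fun r : Fin n → Vec T => √(∑ i, ‖r i‖ ^ 2)) '' feasible C) := by
  rintro _ ⟨r, hr, rfl⟩
  rw [← Real.sqrt_sq_eq_abs, ← Real.sqrt_mul (Nat.cast_nonneg _)]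
  apply Real.sqrt_le_sqrt
  calc ∑ i, ‖r i‖ ^ 2 ≤ ∑ _i : Fin n, R ^ 2 :=
        Finset.sum_le_sum fun i _ => pow_le_pow_left₀ (norm_nonneg _) (hR i _ (hr i)) 2
    _ = n * R ^ 2 := by simp

lemma sum_norm_sq_le_maxNorm {n T : ℕ} {C : Fin n → Set (Vec T)} {R : ℝ}
    (hR : ∀ i, ∀ r ∈ C i, ‖r‖ ≤ R) {r : Fin n → Vec T} (hr : r ∈ feasible C) :
    √(∑ i, ‖r i‖ ^ 2) ≤ maxNorm C :=
  le_csSup ⟨_, bddAbove_image_sqrt_sum hR⟩ ⟨r, hr, rfl⟩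

lemma maxNorm_nonneg {n T : ℕ} (C : Fin n → Set (Vec T)) : 0 ≤ maxNorm C := by
  apply Real.sSup_nonneg
  rintro _ ⟨r, _, rfl⟩
  exact Real.sqrt_nonneg _

lemma maxNorm_le {n T : ℕ} {C : Fin n → Set (Vec T)} {R : ℝ}
    (hR : ∀ i, ∀ r ∈ C i, ‖r‖ ≤ R) : maxNorm C ≤ √n * |R| :=
  Real.sSup_le (bddAbove_image_sqrt_sum hR) (by positivity)

lemma sum_norm_sub_sq_le {n T : ℕ} {C : Fin n → Set (Vec T)} {R : ℝ}
    (hR : ∀ i, ∀ r ∈ C i, ‖r‖ ≤ R) {r z : Fin n → Vec T} (hr : r ∈ feasible C)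
    (hz : z ∈ feasible C) : ∑ i, ‖r i - z i‖ ^ 2 ≤ 4 * maxNorm C ^ 2 := by
  have h1 := Real.sqrt_le_iff.1 (sum_norm_sq_le_maxNorm hR hr)
  have h2 := Real.sqrt_le_iff.1 (sum_norm_sq_le_maxNorm hR hz)
  calc ∑ i, ‖r i - z i‖ ^ 2 ≤ ∑ i, (2 * ‖r i‖ ^ 2 + 2 * ‖z i‖ ^ 2) := by
        refine Finset.sum_le_sum fun i _ => ?_
        have h := norm_sub_le (r i) (z i)
        nlinarith [norm_nonneg (r i - z i), sq_nonneg (‖r i‖ - ‖z i‖)]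
    _ = 2 * (∑ i, ‖r i‖ ^ 2) + 2 * ∑ i, ‖z i‖ ^ 2 := by
        rw [Finset.sum_add_distrib, Finset.mul_sum, Finset.mul_sum]
    _ ≤ _ := by linarith [h1.2, h2.2]

lemma norm_sum_feasible_le {n T : ℕ} {C : Fin n → Set (Vec T)} {R : ℝ}
    (hR : ∀ i, ∀ r ∈ C i, ‖r‖ ≤ R) {r : Fin n → Vec T} (hr : r ∈ feasible C) :
    ‖∑ i, r i‖ ≤ n * R := by
  refine (norm_sum_le _ _).trans ((Finset.sum_le_sum fun i _ => hR i _ (hr i)).trans ?_)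
  simp

lemma upperBounds_norm_gradient {n T : ℕ} {C : Fin n → Set (Vec T)} {R D : ℝ} {d : Vec T}
    (m : ℕ) (hd : ‖d‖ ≤ D) (hR : ∀ i, ∀ r ∈ C i, ‖r‖ ≤ R) :
    1 / m * (D + n / m * |R|) ∈ upperBounds
      ((fun r : Fin n → Vec T => ‖gradient (evCost d m) (∑ i, r i)‖) '' feasible C) := by
  rintro _ ⟨r, hr, rfl⟩
  refine (norm_gradient_evCost_le d m _).trans ?_
  have h : ‖∑ i, r i‖ ≤ n * |R| := (norm_sum_feasible_le hR hr).trans (by gcongr; exact le_abs_self R)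
  calc 1 / (m : ℝ) * (‖d‖ + 1 / m * ‖∑ i, r i‖) ≤ 1 / m * (D + 1 / m * (n * |R|)) := by gcongr
    _ = _ := by ring

lemma norm_gradient_le_maxGrad {n T : ℕ} {C : Fin n → Set (Vec T)} {R : ℝ} {d : Vec T}
    (m : ℕ) (hR : ∀ i, ∀ r ∈ C i, ‖r‖ ≤ R) {r : Fin n → Vec T} (hr : r ∈ feasible C) :
    ‖gradient (evCost d m) (∑ i, r i)‖ ≤ maxGrad (evCost d m) C :=
  le_csSup ⟨_, upperBounds_norm_gradient m le_rfl hR⟩ ⟨r, hr, rfl⟩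

lemma maxGrad_nonneg {n T : ℕ} (U : Vec T → ℝ) (C : Fin n → Set (Vec T)) : 0 ≤ maxGrad U C := by
  apply Real.sSup_nonneg
  rintro _ ⟨r, _, rfl⟩
  exact norm_nonneg _

lemma maxGrad_le {n T : ℕ} {C : Fin n → Set (Vec T)} {R D : ℝ} {d : Vec T}
    (m : ℕ) (hd : ‖d‖ ≤ D) (hR : ∀ i, ∀ r ∈ C i, ‖r‖ ≤ R) :
    maxGrad (evCost d m) C ≤ 1 / m * (D + n / m * |R|) :=
  Real.sSup_le (upperBounds_norm_gradient m hd hR)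
    (by have := (norm_nonneg d).trans hd; positivity)

/-- A bound independent of the algorithm, needed when `ρ = 0` or when `G` is so small relative to
the noise that the optimal iteration count is below 2. -/
lemma evCost_sub_le_maxGrad {n T : ℕ} {C : Fin n → Set (Vec T)} {R : ℝ} (d : Vec T)
    (m : ℕ) (hR : ∀ i, ∀ r ∈ C i, ‖r‖ ≤ R) {r z : Fin n → Vec T} (hr : r ∈ feasible C)
    (hz : z ∈ feasible C) :
    evCost d m (∑ i, r i) - evCost d m (∑ i, z i) ≤
      2 * √n * maxNorm C * maxGrad (evCost d m) C := by
  refine (evCost_sub_le d m _ _).trans ((real_inner_le_norm _ _).trans ?_)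
  have h1 := norm_gradient_le_maxGrad (d := d) m hR hr
  have h2 : ‖∑ i, r i - ∑ i, z i‖ ≤ √n * (2 * maxNorm C) := by
    rw [← Finset.sum_sub_distrib]
    refine (norm_sum_le_sqrt_mul_sqrt _).trans ?_
    gcongr
    refine Real.sqrt_le_iff.2 ⟨mul_nonneg two_pos.le (maxNorm_nonneg C), ?_⟩
    exact (sum_norm_sub_sq_le hR hr hz).trans_eq (by ring)
  calc _ ≤ maxGrad (evCost d m) C * (√n * (2 * maxNorm C)) :=
        mul_le_mul h1 h2 (norm_nonneg _) (maxGrad_nonneg _ _)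
    _ = _ := by ring

/-! ### One step of the method -/

lemma iterate_succ_mem {n T : ℕ} (U : Vec T → ℝ) {C : Fin n → Set (Vec T)}
    (hne : ∀ i, (C i).Nonempty) (hcl : ∀ i, IsClosed (C i)) (hcv : ∀ i, Convex ℝ (C i))
    (α : ℕ → ℝ) (w : ℕ → Vec T) (r₁ : Fin n → Vec T) (k : ℕ) :
    iterate U C α w r₁ (k + 1) ∈ feasible C :=
  fun i => (proj_spec (hne i) (hcl i) (hcv i) _).1

lemma weight_one {η : ℝ} (hη : 1 ≤ η) : weight η 1 = 1 := by
  unfold weight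
  rw [Nat.cast_one]
  exact div_self (by linarith)

lemma weight_nonneg {η : ℝ} (hη : 1 ≤ η) (k : ℕ) : 0 ≤ weight η k := by
  unfold weight
  positivity

lemma weight_succ_le_one {η : ℝ} (hη : 1 ≤ η) (k : ℕ) : weight η (k + 1) ≤ 1 := by
  unfold weight
  rw [div_le_one (by positivity)]
  push_cast
  linarith [(Nat.cast_nonneg k : (0 : ℝ) ≤ k)]

lemma averaged_succ_mem {n T : ℕ} (U : Vec T → ℝ) {C : Fin n → Set (Vec T)}
    (hne : ∀ i, (C i).Nonempty) (hcl : ∀ i, IsClosed (C i)) (hcv : ∀ i, Convex ℝ (C i))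
    (α : ℕ → ℝ) {η : ℝ} (hη : 1 ≤ η) (w : ℕ → Vec T) (r₁ : Fin n → Vec T) (k : ℕ) :
    averaged U C α η w r₁ (k + 1) ∈ feasible C := by
  induction k with
  | zero =>
    intro i
    simpa [averaged, weight_one hη] using iterate_succ_mem U hne hcl hcv α w r₁ 0 i
  | succ k ih =>
    intro i
    exact hcv i (ih i) (iterate_succ_mem U hne hcl hcv α w r₁ (k + 1) i)
      (sub_nonneg.2 (weight_succ_le_one hη _)) (weight_nonneg hη _) (by ring)

lemma evCost_averaged_succ_le {n T : ℕ} (d : Vec T) (m : ℕ) (C : Fin n → Set (Vec T))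
    (α : ℕ → ℝ) {η : ℝ} (hη : 1 ≤ η) (w : ℕ → Vec T) (r₁ : Fin n → Vec T) (k : ℕ) :
    evCost d m (∑ i, averaged (evCost d m) C α η w r₁ (k + 1) i) ≤
      (1 - weight η (k + 1)) * evCost d m (∑ i, averaged (evCost d m) C α η w r₁ k i)
        + weight η (k + 1) * evCost d m (∑ i, iterate (evCost d m) C α w r₁ (k + 1) i) := by
  simp only [averaged, Finset.sum_add_distrib, ← Finset.smul_sum]
  exact (convexOn_evCost d m).2 (Set.mem_univ _) (Set.mem_univ _)
    (sub_nonneg.2 (weight_succ_le_one hη _)) (weight_nonneg hη _) (by ring)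

/-- The basic inequality of the projected gradient method. -/
lemma projected_step_le {n T : ℕ} {C : Fin n → Set (Vec T)}
    (hcl : ∀ i, IsClosed (C i)) (hcv : ∀ i, Convex ℝ (C i)) (d : Vec T) (m : ℕ)
    {z : Fin n → Vec T} (hz : z ∈ feasible C) (y : Fin n → Vec T) {a : ℝ} (ha : 0 ≤ a)
    (w : Vec T) :
    2 * a * (evCost d m (∑ i, y i) - evCost d m (∑ i, z i)) ≤
      ∑ i, ‖y i - z i‖ ^ 2
        - ∑ i, ‖proj (C i) (y i - a • (gradient (evCost d m) (∑ j, y j) + w)) - z i‖ ^ 2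
        + 2 * a ^ 2 * n * (‖gradient (evCost d m) (∑ i, y i)‖ ^ 2 + ‖w‖ ^ 2)
        - 2 * a * ⟪w, ∑ i, y i - ∑ i, z i⟫ := by
  have hc := evCost_sub_le d m (∑ i, y i) (∑ i, z i)
  set g := gradient (evCost d m) (∑ i, y i)
  have h1 : ∑ i, ‖proj (C i) (y i - a • (g + w)) - z i‖ ^ 2 ≤ ∑ i, ‖y i - a • (g + w) - z i‖ ^ 2 :=
    Finset.sum_le_sum fun i _ => pow_le_pow_left₀ (norm_nonneg _)
      (norm_proj_sub_le (hcl i) (hcv i) _ (hz i)) 2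
  have h2 : ∑ i, ‖y i - a • (g + w) - z i‖ ^ 2 =
      ∑ i, ‖y i - z i‖ ^ 2 - 2 * a * ⟪g + w, ∑ i, y i - ∑ i, z i⟫ + n * (a ^ 2 * ‖g + w‖ ^ 2) := by
    have : ∀ i, ‖y i - a • (g + w) - z i‖ ^ 2 =
        ‖y i - z i‖ ^ 2 - 2 * a * ⟪g + w, y i - z i⟫ + a ^ 2 * ‖g + w‖ ^ 2 := by
      intro i
      rw [sub_right_comm, norm_sub_sq_real, real_inner_smul_right, norm_smul, real_inner_comm,
        mul_pow, Real.norm_eq_abs, sq_abs]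
      ring
    simp only [this, Finset.sum_add_distrib, Finset.sum_sub_distrib, ← Finset.mul_sum,
      ← inner_sum, Finset.sum_const, Finset.card_univ, Fintype.card_fin, nsmul_eq_mul]
    ring
  -- A factor 2 is given away here so that no product of gradient and noise remains to be averaged.
  have h3 : ‖g + w‖ ^ 2 ≤ 2 * (‖g‖ ^ 2 + ‖w‖ ^ 2) := by
    have h := norm_add_le g w
    nlinarith [norm_nonneg (g + w), sq_nonneg (‖g‖ - ‖w‖)]
  have h4 : n * (a ^ 2 * ‖g + w‖ ^ 2) ≤ n * (a ^ 2 * (2 * (‖g‖ ^ 2 + ‖w‖ ^ 2))) := by gcongr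
  rw [inner_add_left] at h2
  have h5 := mul_le_mul_of_nonneg_left hc (by positivity : 0 ≤ 2 * a)
  nlinarith

/-! ### Recursion for the averaged suboptimality -/

/-- The term `M - D (k + 1)` makes the induction close: since `(1 - θ_{k+1}) θ_k ≤ θ_{k+1}`, the old
multiple of `M - D (k + 1)` can be raised to the coefficient carried by the new increment `D (k + 1)
- D (k + 2)`, and the two telescope. -/
lemma averaging_bound {K : ℕ} {c η M H : ℝ} (hc : 0 < c) (hη : 1 ≤ η) (hH : 0 ≤ H)
    (e D A : ℕ → ℝ) (hDM : ∀ k, 1 ≤ k → k ≤ K + 1 → D k ≤ M)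
    (hstep : ∀ k, 1 ≤ k → k ≤ K → 2 * (c / √((k + 1 : ℕ) : ℝ)) * e k ≤
      D k - D (k + 1) + (c / √((k + 1 : ℕ) : ℝ)) ^ 2 * H)
    (hA : ∀ k, k < K → A (k + 1) ≤ (1 - weight η (k + 1)) * A k + weight η (k + 1) * e (k + 1))
    {k : ℕ} (hk : 1 ≤ k) (hkK : k ≤ K) :
    A k ≤ weight η k * √((k + 1 : ℕ) : ℝ) / (2 * c) * (M - D (k + 1)) + c * H / √(k : ℝ) := by
  have he : ∀ k, 1 ≤ k → k ≤ K →
      e k ≤ √((k + 1 : ℕ) : ℝ) / (2 * c) * (D k - D (k + 1)) + c * H / (2 * √((k + 1 : ℕ) : ℝ)) := by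
    intro k hk hkK
    have h := hstep k hk hkK
    have hs : 0 < √((k + 1 : ℕ) : ℝ) := Real.sqrt_pos.2 (by positivity)
    set s := √((k + 1 : ℕ) : ℝ)
    have h2 := mul_le_mul_of_nonneg_left h (by positivity : 0 ≤ s / (2 * c))
    have e1 : s / (2 * c) * (2 * (c / s) * e k) = e k := by field_simp
    have e2 : s / (2 * c) * (D k - D (k + 1) + (c / s) ^ 2 * H) =
        s / (2 * c) * (D k - D (k + 1)) + c * H / (2 * s) := by field_simp
    linarith
  have hcH : 0 ≤ c * H := by positivity
  induction k, hk using Nat.le_induction with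
  | base =>
    have h1 := hA 0 (by omega)
    simp only [zero_add, weight_one hη, sub_self, zero_mul, one_mul] at h1 ⊢
    have h2 := he 1 le_rfl hkK
    have h3 : √((1 + 1 : ℕ) : ℝ) / (2 * c) * (D 1 - D (1 + 1)) ≤
        √((1 + 1 : ℕ) : ℝ) / (2 * c) * (M - D (1 + 1)) := by
      gcongr
      exact hDM 1 le_rfl (by omega)
    have h4 : c * H / (2 * √((1 + 1 : ℕ) : ℝ)) ≤ c * H / √((1 : ℕ) : ℝ) := by
      refine div_le_div_of_nonneg_left hcH (by simp) ?_
      have : √((1 : ℕ) : ℝ) ≤ √((1 + 1 : ℕ) : ℝ) := Real.sqrt_le_sqrt (by norm_num)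
      linarith [Real.sqrt_nonneg ((1 + 1 : ℕ) : ℝ)]
    linarith
  | succ k hk ih =>
    have hk0 : (1 : ℝ) ≤ k := by exact_mod_cast hk
    have h1 := hA k (by omega)
    have h2 := he (k + 1) (by omega) hkK
    have h3 := ih (by omega)
    have hD := hDM (k + 1) (by omega) (by omega)
    set θ := weight η (k + 1) with hθ
    have hθ0 : 0 ≤ θ := weight_nonneg hη _
    have hθ1 : 0 ≤ 1 - θ := sub_nonneg.2 (weight_succ_le_one hη _)
    have hη0 : 0 < η + (k + 1) := by linarith
    have h1θ : 1 - θ = k / (η + (k + 1)) := by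
      rw [hθ, weight]
      push_cast
      field_simp
      ring
    set s := √((k + 1 : ℕ) : ℝ)
    set s' := √((k + 1 + 1 : ℕ) : ℝ)
    have hss' : s ≤ s' := Real.sqrt_le_sqrt (by push_cast; linarith)
    have hs : 0 < s := Real.sqrt_pos.2 (by positivity)
    have hs' : 0 < s' := Real.sqrt_pos.2 (by positivity)
    have hkp : 0 < √(k : ℝ) := Real.sqrt_pos.2 (by linarith)
    have hks : √(k : ℝ) ≤ s := Real.sqrt_le_sqrt (by push_cast; linarith)
    have hww : (1 - θ) * weight η k ≤ θ := by
      rw [h1θ, hθ, weight, weight]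
      push_cast
      rw [div_mul_div_comm, div_le_div_iff₀ (by positivity) hη0]
      nlinarith [mul_nonneg (by positivity : 0 ≤ (η + 1) * (η + (k + 1))) (by linarith : 0 ≤ η)]
    have h4 := mul_le_mul_of_nonneg_left h3 hθ1
    have h5 := mul_le_mul_of_nonneg_left h2 hθ0
    have h6 : (1 - θ) * (weight η k * s / (2 * c) * (M - D (k + 1))) ≤
        θ * s' / (2 * c) * (M - D (k + 1)) := by
      have hMD : 0 ≤ M - D (k + 1) := sub_nonneg.2 hD
      calc (1 - θ) * (weight η k * s / (2 * c) * (M - D (k + 1)))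
          = ((1 - θ) * weight η k) * s / (2 * c) * (M - D (k + 1)) := by ring
        _ ≤ _ := by gcongr
    -- The two summands are compared with the shares `(k + 1) / (η + k + 1)` and `η / (η + k + 1)`
    -- of `c H / s`; the second comparison uses `(η + 1) / 2 ≤ η`.
    have h7 : (1 - θ) * (c * H / √(k : ℝ)) + θ * (c * H / (2 * s')) ≤ c * H / s := by
      have e1 : (1 - θ) / √(k : ℝ) + θ / (2 * s') ≤ 1 / s := by
        have a1 : (1 - θ) / √(k : ℝ) = √(k : ℝ) / (η + (k + 1)) := by
          rw [h1θ, div_right_comm, Real.div_sqrt]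
        have a2 : θ / (2 * s') ≤ η / (η + (k + 1)) / s := by
          have : θ / 2 ≤ η / (η + (k + 1)) := by
            rw [hθ, weight]
            push_cast
            rw [div_div, div_le_div_iff₀ (by positivity) hη0]
            nlinarith
          rw [← div_div]
          exact div_le_div₀ (by positivity) this hs hss'
        have a3 : √(k : ℝ) / (η + (k + 1)) ≤ (k + 1) / (η + (k + 1)) / s := by
          rw [div_right_comm]
          gcongr
          rw [le_div_iff₀ hs]
          have : s * s = k + 1 := by
            have := Real.mul_self_sqrt (by positivity : (0 : ℝ) ≤ ((k + 1 : ℕ) : ℝ))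
            rw [this]; push_cast; ring
          nlinarith
        rw [a1]
        calc √(k : ℝ) / (η + (k + 1)) + θ / (2 * s')
            ≤ (k + 1) / (η + (k + 1)) / s + η / (η + (k + 1)) / s := add_le_add a3 a2
          _ = 1 / s := by
            rw [← add_div, ← add_div, add_comm ((k : ℝ) + 1), div_self hη0.ne']
      calc _ = c * H * ((1 - θ) / √(k : ℝ) + θ / (2 * s')) := by ring
        _ ≤ c * H * (1 / s) := by gcongr
        _ = _ := by ring
    have e8 : θ * (s' / (2 * c) * (D (k + 1) - D (k + 1 + 1)) + c * H / (2 * s')) =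
        θ * s' / (2 * c) * (M - D (k + 1 + 1)) - θ * s' / (2 * c) * (M - D (k + 1))
          + θ * (c * H / (2 * s')) := by ring
    rw [e8] at h5
    rw [mul_add] at h4
    linarith

/-! ### Moments of the noise -/

lemma integral_pow_mul_exp_neg_mul_Ioi (n : ℕ) {a : ℝ} (ha : 0 < a) :
    ∫ t in Set.Ioi (0 : ℝ), t ^ n * Real.exp (-(a * t)) = (1 / a) ^ (n + 1) * n.factorial := by
  have h := Real.integral_rpow_mul_exp_neg_mul_Ioi (a := (n : ℝ) + 1) (r := a) (by positivity) ha
  rw [Real.Gamma_nat_eq_factorial] at h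
  have e : (1 / a) ^ ((n : ℝ) + 1) = (1 / a) ^ (n + 1) := by
    rw [← Real.rpow_natCast]
    push_cast
    rfl
  rw [e] at h
  rw [← h]
  refine setIntegral_congr_fun measurableSet_Ioi fun t _ => ?_
  simp

/-- Polar coordinates reduce this to a Gamma integral with exponent `T + j - 1`. The ball volume
cancels in every normalized moment. -/
lemma integral_norm_pow_mul_exp {T : ℕ} (hT : 0 < T) {a : ℝ} (ha : 0 < a) (j : ℕ) :
    ∫ x : Vec T, ‖x‖ ^ j * Real.exp (-(a * ‖x‖)) =
      T * (volume.real (Metric.ball (0 : Vec T) 1) *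
        ((1 / a) ^ (T + j) * (T + j - 1).factorial)) := by
  have : Nontrivial (Vec T) := by
    have : Nonempty (Fin T) := ⟨⟨0, hT⟩⟩
    infer_instance
  rw [integral_fun_norm_addHaar (volume : Measure (Vec T)) fun t => t ^ j * Real.exp (-(a * t))]
  simp only [finrank_euclideanSpace, Fintype.card_fin, nsmul_eq_mul, smul_eq_mul]
  have h := integral_pow_mul_exp_neg_mul_Ioi (T + j - 1) ha
  rw [show T + j - 1 + 1 = T + j by omega] at h
  rw [← h]
  simp only [← mul_assoc, ← pow_add]
  rw [show T - 1 + j = T + j - 1 by omega]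

lemma integral_norm_pow_mul_exp_pos {T : ℕ} (hT : 0 < T) {a : ℝ} (ha : 0 < a) (j : ℕ) :
    0 < ∫ x : Vec T, ‖x‖ ^ j * Real.exp (-(a * ‖x‖)) := by
  rw [integral_norm_pow_mul_exp hT ha]
  have h1 : 0 < volume.real (Metric.ball (0 : Vec T) 1) :=
    ENNReal.toReal_pos (Metric.measure_ball_pos _ _ one_pos).ne' measure_ball_lt_top.ne
  have h2 : (0 : ℝ) < T := by exact_mod_cast hT
  positivity

lemma integral_noiseLaw {T : ℕ} (hT : 0 < T) {a : ℝ} (ha : 0 < a) {F : Type*}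
    [NormedAddCommGroup F] [NormedSpace ℝ F] (f : Vec T → F) :
    ∫ x, f x ∂(noiseLaw T a) =
      (∫ x : Vec T, Real.exp (-(a * ‖x‖)))⁻¹ • ∫ x, Real.exp (-(a * ‖x‖)) • f x := by
  have h0 := integral_norm_pow_mul_exp_pos hT ha 0
  simp only [pow_zero, one_mul] at h0
  -- A non-integrable function has Bochner integral 0, so the positive value just computed already
  -- proves integrability.
  have hint : Integrable (fun x : Vec T => Real.exp (-(a * ‖x‖))) :=
    Integrable.of_integral_ne_zero h0.ne'
  rw [noiseLaw, integral_smul_measure,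
    ← ofReal_integral_eq_lintegral_ofReal hint (.of_forall fun _ => (Real.exp_pos _).le),
    integral_withDensity_eq_integral_toReal_smul (by fun_prop) (by simp), ENNReal.toReal_inv,
    ENNReal.toReal_ofReal h0.le]
  simp only [ENNReal.toReal_ofReal (Real.exp_pos _).le]

lemma integral_norm_sq_noiseLaw {T : ℕ} (hT : 0 < T) {a : ℝ} (ha : 0 < a) :
    ∫ x, ‖x‖ ^ 2 ∂(noiseLaw T a) = T * (T + 1) / a ^ 2 := by
  have h0 := integral_norm_pow_mul_exp hT ha 0
  have h2 := integral_norm_pow_mul_exp hT ha 2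
  have hp := integral_norm_pow_mul_exp_pos hT ha 0
  rw [h0] at hp
  rw [integral_noiseLaw hT ha]
  simp only [pow_zero, one_mul, add_zero] at h0 hp
  simp only [smul_eq_mul, mul_comm (Real.exp _), h0, h2]
  obtain ⟨t, rfl⟩ : ∃ t, T = t + 1 := ⟨T - 1, by omega⟩
  simp only [Nat.add_sub_cancel, show t + 1 + 2 - 1 = t + 1 + 1 by omega, Nat.factorial_succ,
    pow_add (1 / a) (t + 1) 2] at hp ⊢
  have h1 := (pos_of_mul_pos_right (pos_of_mul_pos_right hp (by positivity))
    measureReal_nonneg)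
  have h3 := pos_of_mul_pos_left (pos_of_mul_pos_right hp (by positivity)) h1.le
  push_cast
  field_simp

/-- The density is even, so the integral equals its own negative. -/
lemma integral_id_noiseLaw {T : ℕ} (hT : 0 < T) {a : ℝ} (ha : 0 < a) :
    ∫ x, x ∂(noiseLaw T a) = 0 := by
  rw [integral_noiseLaw hT ha]
  have h := integral_neg_eq_self (fun x : Vec T => Real.exp (-(a * ‖x‖)) • x) volume
  simp only [norm_neg, smul_neg, integral_neg] at h
  have h2 : (2 : ℝ) • ∫ x : Vec T, Real.exp (-(a * ‖x‖)) • x = 0 := by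
    rw [two_smul]
    nth_rewrite 1 [← h]
    exact neg_add_cancel _
  rw [(smul_eq_zero.1 h2).resolve_left two_ne_zero, smul_zero]

lemma integrable_norm_sq_noiseLaw {T : ℕ} (hT : 0 < T) {a : ℝ} (ha : 0 < a) :
    Integrable (fun x => ‖x‖ ^ 2) (noiseLaw T a) := by
  apply Integrable.of_integral_ne_zero
  have : (0 : ℝ) < T := by exact_mod_cast hT
  rw [integral_norm_sq_noiseLaw hT ha]
  positivity

section
variable {Ω : Type*} [MeasurableSpace Ω] {P : Measure Ω} {T : ℕ} {a : ℝ}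
  {w : Ω → Vec T}

lemma integral_norm_sq_of_hasLaw (hT : 0 < T) (ha : 0 < a) (hw : HasLaw w (noiseLaw T a) P) :
    ∫ ω, ‖w ω‖ ^ 2 ∂P = T * (T + 1) / a ^ 2 := by
  rw [← integral_norm_sq_noiseLaw hT ha]
  exact hw.integral_comp (f := fun x => ‖x‖ ^ 2) (by fun_prop)

lemma integral_eq_zero_of_hasLaw (hT : 0 < T) (ha : 0 < a) (hw : HasLaw w (noiseLaw T a) P) :
    ∫ ω, w ω ∂P = 0 := by
  rw [hw.integral_eq, integral_id_noiseLaw hT ha]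

lemma integrable_norm_sq_of_hasLaw (hT : 0 < T) (ha : 0 < a) (hw : HasLaw w (noiseLaw T a) P) :
    Integrable (fun ω => ‖w ω‖ ^ 2) P := by
  have h := integrable_norm_sq_noiseLaw hT ha
  rw [← hw.map_eq] at h
  exact h.comp_aemeasurable hw.aemeasurable

lemma integrable_of_hasLaw [IsProbabilityMeasure P] (hT : 0 < T) (ha : 0 < a) (hw : HasLaw w (noiseLaw T a) P) :
    Integrable w P := by
  refine ((integrable_norm_sq_of_hasLaw hT ha hw).add (integrable_const 1)).mono'
    hw.aemeasurable.aestronglyMeasurable (.of_forall fun ω => ?_)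
  simp only [Pi.add_apply]
  nlinarith [sq_nonneg (‖w ω‖ - 1), norm_nonneg (w ω)]

end

/-! ### Dependence of the iterates on the noise -/

lemma iterate_congr {n T : ℕ} (U : Vec T → ℝ) (C : Fin n → Set (Vec T)) (α : ℕ → ℝ)
    (r₁ : Fin n → Vec T) {v v' : ℕ → Vec T} {k : ℕ} (h : ∀ j, 1 ≤ j → j ≤ k → v j = v' j) :
    iterate U C α v r₁ k = iterate U C α v' r₁ k := by
  induction k with
  | zero => rfl
  | succ k ih =>
    simp only [iterate, ih fun j h1 h2 => h j h1 (by omega), h (k + 1) (by omega) le_rfl]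

lemma averaged_congr {n T : ℕ} (U : Vec T → ℝ) (C : Fin n → Set (Vec T)) (α : ℕ → ℝ) (η : ℝ)
    (r₁ : Fin n → Vec T) {v v' : ℕ → Vec T} {k : ℕ} (h : ∀ j, 1 ≤ j → j ≤ k → v j = v' j) :
    averaged U C α η v r₁ k = averaged U C α η v' r₁ k := by
  induction k with
  | zero => rfl
  | succ k ih =>
    simp only [averaged, ih fun j h1 h2 => h j h1 (by omega), iterate_congr U C α r₁ h]

section measurability

variable {n T : ℕ} {U : Vec T → ℝ} (hU : Continuous (gradient U)) {C : Fin n → Set (Vec T)}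
  (hne : ∀ i, (C i).Nonempty) (hcl : ∀ i, IsClosed (C i)) (hcv : ∀ i, Convex ℝ (C i))
  (α : ℕ → ℝ) (η : ℝ) (r₁ : Fin n → Vec T)

include hU hne hcl hcv

lemma measurable_iterate (k : ℕ) :
    Measurable fun v : ℕ → Vec T => iterate U C α v r₁ k := by
  induction k with
  | zero => exact measurable_const
  | succ k ih =>
    refine measurable_pi_lambda _ fun i => ?_
    have hi : ∀ i, Measurable fun v : ℕ → Vec T => iterate U C α v r₁ k i :=
      fun i => (measurable_pi_apply i).comp ih
    have hg : Measurable fun v : ℕ → Vec T => gradient U (∑ j, iterate U C α v r₁ k j) :=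
      hU.measurable.comp (Finset.measurable_fun_sum _ fun i _ => hi i)
    refine (continuous_proj (hne i) (hcl i) (hcv i)).measurable.comp ?_
    fun_prop

lemma measurable_averaged (k : ℕ) :
    Measurable fun v : ℕ → Vec T => averaged U C α η v r₁ k := by
  induction k with
  | zero => exact measurable_const
  | succ k ih =>
    refine measurable_pi_lambda _ fun i => ?_
    have h1 : Measurable fun v : ℕ → Vec T => averaged U C α η v r₁ k i :=
      (measurable_pi_apply i).comp ih
    have h2 : Measurable fun v : ℕ → Vec T => iterate U C α v r₁ (k + 1) i :=
      (measurable_pi_apply i).comp (measurable_iterate hU hne hcl hcv α r₁ (k + 1))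
    simp only [averaged]
    fun_prop

variable {Ω : Type*} [MeasurableSpace Ω] {P : Measure Ω} {w : ℕ → Ω → Vec T}

lemma aemeasurable_iterate {k : ℕ} (hw : ∀ j, 1 ≤ j → j ≤ k → AEMeasurable (w j) P) :
    AEMeasurable (fun ω => iterate U C α (fun j => w j ω) r₁ k) P := by
  -- Nothing is known about the measurability of the other `w j`, so they are replaced by 0; the
  -- iterate does not see them.
  have h : AEMeasurable (fun ω j => if 1 ≤ j ∧ j ≤ k then w j ω else 0) P := by
    refine aemeasurable_pi_lambda _ fun j => ?_
    by_cases hj : 1 ≤ j ∧ j ≤ k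
    · simpa [hj] using hw j hj.1 hj.2
    · simp [hj]
  refine ((measurable_iterate hU hne hcl hcv α r₁ k).comp_aemeasurable h).congr
    (.of_forall fun ω => ?_)
  exact iterate_congr U C α r₁ fun j h1 h2 => if_pos ⟨h1, h2⟩

lemma aemeasurable_averaged {k : ℕ} (hw : ∀ j, 1 ≤ j → j ≤ k → AEMeasurable (w j) P) :
    AEMeasurable (fun ω => averaged U C α η (fun j => w j ω) r₁ k) P := by
  have h : AEMeasurable (fun ω j => if 1 ≤ j ∧ j ≤ k then w j ω else 0) P := by
    refine aemeasurable_pi_lambda _ fun j => ?_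
    by_cases hj : 1 ≤ j ∧ j ≤ k
    · simpa [hj] using hw j hj.1 hj.2
    · simp [hj]
  refine ((measurable_averaged hU hne hcl hcv α η r₁ k).comp_aemeasurable h).congr
    (.of_forall fun ω => ?_)
  exact averaged_congr U C α η r₁ fun j h1 h2 => if_pos ⟨h1, h2⟩

lemma IsNoise.indepFun_iterate {K : ℕ} {L Δ ε : ℝ} (hw : IsNoise P K L Δ ε w) {k : ℕ}
    (hk : 1 ≤ k) (hkK : k < K) :
    IndepFun (fun ω => iterate U C α (fun j => w j ω) r₁ k) (w (k + 1)) P := by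
  classical
  let S : Finset (Set.Icc 2 K) := Finset.univ.filter fun j => (j : ℕ) ≤ k
  let k' : Set.Icc 2 K := ⟨k + 1, by omega, by omega⟩
  have hd : Disjoint S {k'} := by
    simp [S, k']
  have h := hw.indep.indepFun_finset₀ S {k'} hd fun j => (hw.law j j.2.1 j.2.2).aemeasurable
  -- Rebuilds a noise sequence from the coordinates in `S`. The default 0 at index 1 is the true
  -- value, since the first noise vector vanishes.
  let φ : (S → Vec T) → ℕ → Vec T := fun v j =>
    if hj : j ∈ Set.Icc 2 K ∧ j ≤ k then v ⟨⟨j, hj.1⟩, by simp [S, hj.2]⟩ else 0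
  have hφ : Measurable φ := by
    refine measurable_pi_lambda _ fun j => ?_
    by_cases hj : j ∈ Set.Icc 2 K ∧ j ≤ k
    · simpa only [φ, dif_pos hj] using measurable_pi_apply _
    · simpa only [φ, dif_neg hj] using measurable_const
  have h2 := h.comp ((measurable_iterate hU hne hcl hcv α r₁ k).comp hφ)
    (measurable_pi_apply (⟨k', Finset.mem_singleton_self _⟩ : ({k'} : Finset (Set.Icc 2 K))))
  refine h2.congr (.of_forall fun ω => ?_) (.of_forall fun ω => rfl)
  symm
  refine iterate_congr U C α r₁ fun j h1 h2 => ?_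
  by_cases hj : j = 1
  · subst hj
    simp [φ, hw.first]
  · have : j ∈ Set.Icc 2 K ∧ j ≤ k := ⟨⟨by omega, by omega⟩, h2⟩
    simp only [φ, dif_pos this]

end measurability

lemma IsNoise.aemeasurable {T : ℕ} {Ω : Type*} [MeasurableSpace Ω] {P : Measure Ω}
    {w : ℕ → Ω → Vec T} {K : ℕ} {L Δ ε : ℝ} (hw : IsNoise P K L Δ ε w) {j : ℕ} (h1 : 1 ≤ j)
    (h2 : j ≤ K) : AEMeasurable (w j) P := by
  by_cases hj : j = 1
  · subst hj
    rw [show w 1 = fun _ => 0 from funext hw.first]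
    exact aemeasurable_const
  · exact (hw.law j (by omega) h2).aemeasurable

lemma integrable_comp_of_mem_feasible {n T : ℕ} {Ω : Type*} [MeasurableSpace Ω] {P : Measure Ω}
    [IsProbabilityMeasure P] {C : Fin n → Set (Vec T)} {R : ℝ}
    (hR : ∀ i, ∀ r ∈ C i, ‖r‖ ≤ R) {Y : Ω → Fin n → Vec T} (hY : AEMeasurable Y P)
    (hYC : ∀ ω, Y ω ∈ feasible C) {F : Type*} [NormedAddCommGroup F] [SecondCountableTopology F]
    [MeasurableSpace F] [BorelSpace F] {f : (Fin n → Vec T) → F}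
    (hf : Continuous f) : Integrable (fun ω => f (Y ω)) P := by
  obtain ⟨b, hb⟩ := (isCompact_univ_pi fun _ : Fin n =>
    isCompact_closedBall (0 : Vec T) R).exists_bound_of_continuousOn hf.continuousOn
  refine (integrable_const b).mono' (hf.measurable.comp_aemeasurable hY).aestronglyMeasurable
    (.of_forall fun ω => hb _ fun i _ => ?_)
  simpa using hR i _ (hYC ω i)

/-- Uses `T + 1 ≤ 2 T` and `K - 1 ≤ K`; this is the origin of the noise term in `Ĝ`. -/
lemma noise_second_moment_le {T K : ℕ} {L Δ ε : ℝ} (hT : 0 < T) (hK : 2 ≤ K) (hε : 0 < ε)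
    (hL : 0 < L) (hΔ : 0 < Δ) :
    T * (T + 1) / (2 * ε / ((K : ℝ) * ((K : ℝ) - 1) * L * Δ)) ^ 2 ≤
      (√2 * T * K ^ 2 * L * Δ / (2 * ε)) ^ 2 := by
  have hK' : (2 : ℝ) ≤ K := by exact_mod_cast hK
  have hT' : (1 : ℝ) ≤ T := by exact_mod_cast hT
  have h1 : (0 : ℝ) < K - 1 := by linarith
  have e1 : T * (T + 1) / (2 * ε / ((K : ℝ) * ((K : ℝ) - 1) * L * Δ)) ^ 2 =
      (T * (T + 1)) * (K * (K - 1)) ^ 2 * (L * Δ / (2 * ε)) ^ 2 := by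
    field_simp
  have e2 : (√2 * T * K ^ 2 * L * Δ / (2 * ε)) ^ 2 =
      (2 * T ^ 2) * (K * K) ^ 2 * (L * Δ / (2 * ε)) ^ 2 := by
    have : √2 ^ 2 = (2 : ℝ) := Real.sq_sqrt (by norm_num)
    calc _ = √2 ^ 2 * T ^ 2 * (K * K) ^ 2 * (L * Δ / (2 * ε)) ^ 2 := by ring
      _ = _ := by rw [this]
  rw [e1, e2]
  have h2 : (T : ℝ) * (T + 1) ≤ 2 * T ^ 2 := by nlinarith
  gcongr
  linarith

/-! ### Expected suboptimality -/

section expectation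

variable {n T : ℕ} {C : Fin n → Set (Vec T)}
  (hne : ∀ i, (C i).Nonempty) (hcl : ∀ i, IsClosed (C i)) (hcv : ∀ i, Convex ℝ (C i))
  {R : ℝ} (hR : ∀ i, ∀ r ∈ C i, ‖r‖ ≤ R) (d : Vec T) (m : ℕ) (α : ℕ → ℝ) (r₁ : Fin n → Vec T)
  {Ω : Type*} [MeasurableSpace Ω] {P : Measure Ω} [IsProbabilityMeasure P] {w : ℕ → Ω → Vec T}
  {K : ℕ} {L Δ ε : ℝ} (hw : IsNoise P K L Δ ε w)

include hne hcl hcv hR hw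

lemma integrable_comp_iterate {k : ℕ} (hk : 1 ≤ k) (hkK : k ≤ K) {F : Type*}
    [NormedAddCommGroup F] [SecondCountableTopology F] [MeasurableSpace F] [BorelSpace F]
    {f : (Fin n → Vec T) → F} (hf : Continuous f) :
    Integrable (fun ω => f (iterate (evCost d m) C α (fun j => w j ω) r₁ k)) P := by
  refine integrable_comp_of_mem_feasible hR (aemeasurable_iterate (continuous_gradient_evCost d m)
    hne hcl hcv α r₁ fun j h1 h2 => hw.aemeasurable h1 (h2.trans hkK)) (fun ω => ?_) hf
  obtain ⟨k, rfl⟩ : ∃ l, k = l + 1 := ⟨k - 1, by omega⟩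
  exact iterate_succ_mem _ hne hcl hcv _ _ _ _

lemma integrable_comp_averaged {η : ℝ} (hη : 1 ≤ η) {k : ℕ} (hkK : k ≤ K) {F : Type*}
    [NormedAddCommGroup F] [SecondCountableTopology F] [MeasurableSpace F] [BorelSpace F]
    {f : (Fin n → Vec T) → F} (hf : Continuous f) :
    Integrable (fun ω => f (averaged (evCost d m) C α η (fun j => w j ω) r₁ k)) P := by
  cases k with
  | zero => exact integrable_const (f r₁)
  | succ k =>
    exact integrable_comp_of_mem_feasible hR
      (aemeasurable_averaged (continuous_gradient_evCost d m) hne hcl hcv α η r₁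
        fun j h1 h2 => hw.aemeasurable h1 (h2.trans hkK))
      (fun ω => averaged_succ_mem _ hne hcl hcv _ hη _ _ _) hf

variable {S : ℝ} (hS0 : 0 ≤ S)
  (hS : ∀ k, 2 ≤ k → k ≤ K → Integrable (w k) P ∧ Integrable (fun ω => ‖w k ω‖ ^ 2) P ∧
    ∫ ω, ‖w k ω‖ ^ 2 ∂P ≤ S ∧ ∫ ω, w k ω ∂P = 0)
  {z : Fin n → Vec T} (hz : z ∈ feasible C)

include hz hS

/-- `k ≥ 1` makes the iterate feasible, hence its gradient at most `G`; `k < K` ensures that `w (k +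
1)` is a genuine noise vector. -/
lemma expected_step_le {k : ℕ} (hk : 1 ≤ k) (hkK : k < K) (hα : 0 ≤ α (k + 1)) :
    2 * α (k + 1) * (∫ ω, evCost d m (∑ i, iterate (evCost d m) C α (fun j => w j ω) r₁ k i) ∂P
        - evCost d m (∑ i, z i)) ≤
      ∫ ω, ∑ i, ‖iterate (evCost d m) C α (fun j => w j ω) r₁ k i - z i‖ ^ 2 ∂P
        - ∫ ω, ∑ i, ‖iterate (evCost d m) C α (fun j => w j ω) r₁ (k + 1) i - z i‖ ^ 2 ∂P
        + α (k + 1) ^ 2 * (2 * n * (maxGrad (evCost d m) C ^ 2 + S)) := by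
  obtain ⟨hwi, hw2, hwS, hw0⟩ := hS (k + 1) (by omega) hkK
  set a := α (k + 1)
  set y := fun ω => iterate (evCost d m) C α (fun j => w j ω) r₁ k
  set y' := fun ω => iterate (evCost d m) C α (fun j => w j ω) r₁ (k + 1)
  set G := maxGrad (evCost d m) C
  have hyC : ∀ ω, y ω ∈ feasible C := by
    intro ω
    obtain ⟨l, rfl⟩ : ∃ l, k = l + 1 := ⟨k - 1, by omega⟩
    exact iterate_succ_mem _ hne hcl hcv _ _ _ _
  have hUi : Integrable (fun ω => evCost d m (∑ i, y ω i)) P :=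
    integrable_comp_iterate hne hcl hcv hR d m α r₁ hw hk hkK.le
      (f := fun x => evCost d m (∑ i, x i)) ((continuous_evCost d m).comp (by fun_prop))
  have hDi : Integrable (fun ω => ∑ i, ‖y ω i - z i‖ ^ 2) P :=
    integrable_comp_iterate hne hcl hcv hR d m α r₁ hw hk hkK.le
      (f := fun x => ∑ i, ‖x i - z i‖ ^ 2) (by fun_prop)
  have hDi' : Integrable (fun ω => ∑ i, ‖y' ω i - z i‖ ^ 2) P :=
    integrable_comp_iterate hne hcl hcv hR d m α r₁ hw (by omega) hkK
      (f := fun x => ∑ i, ‖x i - z i‖ ^ 2) (by fun_prop)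
  have hXi : Integrable (fun ω => ∑ i, y ω i - ∑ i, z i) P :=
    integrable_comp_iterate hne hcl hcv hR d m α r₁ hw hk hkK.le
      (f := fun x => ∑ i, x i - ∑ i, z i) (by fun_prop)
  have hind : IndepFun (w (k + 1)) (fun ω => ∑ i, y ω i - ∑ i, z i) P := by
    have h := (IsNoise.indepFun_iterate (continuous_gradient_evCost d m) hne hcl hcv α r₁ hw
      hk hkK).symm
    exact h.comp measurable_id
      ((by fun_prop : Continuous fun x : Fin n → Vec T => ∑ i, x i - ∑ i, z i).measurable)
  have hcross : ∫ ω, ⟪w (k + 1) ω, ∑ i, y ω i - ∑ i, z i⟫ ∂P = 0 := by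
    have h := hind.integral_bilin hwi hXi (innerSL ℝ)
    rw [hw0, map_zero, _root_.zero_apply] at h
    exact h
  have hcrossi : Integrable (fun ω => ⟪w (k + 1) ω, ∑ i, y ω i - ∑ i, z i⟫) P := by
    refine (hwi.norm.mul_const (n * R + ‖∑ i, z i‖)).mono'
      (hwi.aestronglyMeasurable.inner hXi.aestronglyMeasurable) (.of_forall fun ω => ?_)
    refine (norm_inner_le_norm _ _).trans ?_
    gcongr
    exact (norm_sub_le _ _).trans (by gcongr; exact norm_sum_feasible_le hR (hyC ω))
  have hpt : ∀ ω, 2 * a * (evCost d m (∑ i, y ω i) - evCost d m (∑ i, z i)) ≤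
      ∑ i, ‖y ω i - z i‖ ^ 2 - ∑ i, ‖y' ω i - z i‖ ^ 2
        + (2 * a ^ 2 * n * G ^ 2 + 2 * a ^ 2 * n * ‖w (k + 1) ω‖ ^ 2)
        - 2 * a * ⟪w (k + 1) ω, ∑ i, y ω i - ∑ i, z i⟫ := by
    intro ω
    have h := projected_step_le hcl hcv d m hz (y ω) hα (w (k + 1) ω)
    have hG := pow_le_pow_left₀ (norm_nonneg _) (norm_gradient_le_maxGrad (d := d) m hR (hyC ω)) 2
    have h2 : 2 * a ^ 2 * n * (‖gradient (evCost d m) (∑ i, y ω i)‖ ^ 2 + ‖w (k + 1) ω‖ ^ 2) ≤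
        2 * a ^ 2 * n * (G ^ 2 + ‖w (k + 1) ω‖ ^ 2) := by gcongr
    have h3 : ∀ i, y' ω i = proj (C i)
      (y ω i - a • (gradient (evCost d m) (∑ j, y ω j) + w (k + 1) ω)) := fun i => rfl
    simp only [h3]
    linarith
  have i1 := (hDi.sub hDi')
  have i2 := (integrable_const (μ := P) (2 * a ^ 2 * n * G ^ 2)).add
    (hw2.const_mul (2 * a ^ 2 * n))
  have h := integral_mono ((hUi.sub (integrable_const (evCost d m (∑ i, z i)))).const_mul (2 * a))
    ((i1.add i2).sub (hcrossi.const_mul (2 * a))) hpt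
  rw [integral_const_mul, integral_sub' hUi (integrable_const _), integral_sub' (i1.add i2)
    (hcrossi.const_mul (2 * a)), integral_add' i1 i2, integral_sub' hDi hDi',
    integral_add' (integrable_const _) (hw2.const_mul _), integral_const_mul, integral_const_mul,
    integral_const_mul, hcross, integral_const, integral_const, probReal_univ, one_smul, one_smul] at h
  have h4 : 2 * a ^ 2 * n * ∫ ω, ‖w (k + 1) ω‖ ^ 2 ∂P ≤ 2 * a ^ 2 * n * S := by gcongr
  linarith

include hS0

lemma expected_averaged_sub_le (hK : 1 ≤ K) {c : ℝ} (hc : 0 < c) {η : ℝ} (hη : 1 ≤ η) :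
    ∫ ω, evCost d m (∑ i, averaged (evCost d m) C (fun k => c / √(k : ℝ)) η (fun j => w j ω)
        r₁ K i) ∂P - evCost d m (∑ i, z i) ≤
      weight η K * √((K + 1 : ℕ) : ℝ) / (2 * c) * (4 * maxNorm C ^ 2)
        + c * (2 * n * (maxGrad (evCost d m) C ^ 2 + S)) / √(K : ℝ) := by
  set α : ℕ → ℝ := fun k => c / √(k : ℝ) with hα
  set G := maxGrad (evCost d m) C
  have hα0 : ∀ k, 0 ≤ α k := fun k => by positivity
  have hyC : ∀ k, 1 ≤ k → ∀ ω, iterate (evCost d m) C α (fun j => w j ω) r₁ k ∈ feasible C := by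
    intro k hk ω
    obtain ⟨l, rfl⟩ : ∃ l, k = l + 1 := ⟨k - 1, by omega⟩
    exact iterate_succ_mem _ hne hcl hcv _ _ _ _
  have hUi : ∀ k, 1 ≤ k → k ≤ K → Integrable (fun ω =>
      evCost d m (∑ i, iterate (evCost d m) C α (fun j => w j ω) r₁ k i)) P := fun k hk hkK =>
    integrable_comp_iterate hne hcl hcv hR d m α r₁ hw hk hkK
      (f := fun x => evCost d m (∑ i, x i)) ((continuous_evCost d m).comp (by fun_prop))
  have hDi : ∀ k, 1 ≤ k → k ≤ K → Integrable (fun ω =>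
      ∑ i, ‖iterate (evCost d m) C α (fun j => w j ω) r₁ k i - z i‖ ^ 2) P := fun k hk hkK =>
    integrable_comp_iterate hne hcl hcv hR d m α r₁ hw hk hkK
      (f := fun x => ∑ i, ‖x i - z i‖ ^ 2) (by fun_prop)
  have hAi : ∀ k, k ≤ K → Integrable (fun ω =>
      evCost d m (∑ i, averaged (evCost d m) C α η (fun j => w j ω) r₁ k i)) P := fun k hkK =>
    integrable_comp_averaged hne hcl hcv hR d m α r₁ hw hη hkK
      (f := fun x => evCost d m (∑ i, x i)) ((continuous_evCost d m).comp (by fun_prop))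
  let e : ℕ → ℝ := fun k =>
    ∫ ω, evCost d m (∑ i, iterate (evCost d m) C α (fun j => w j ω) r₁ k i) ∂P
      - evCost d m (∑ i, z i)
  -- The output involves `iterate` up to index `K`, but the method takes no step from that point.
  -- Setting `D (K + 1) = 0` allows a fictitious last step.
  let D : ℕ → ℝ := fun k => if k ≤ K then
    ∫ ω, ∑ i, ‖iterate (evCost d m) C α (fun j => w j ω) r₁ k i - z i‖ ^ 2 ∂P else 0
  let A : ℕ → ℝ := fun k =>
    ∫ ω, evCost d m (∑ i, averaged (evCost d m) C α η (fun j => w j ω) r₁ k i) ∂P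
      - evCost d m (∑ i, z i)
  have hDM : ∀ k, 1 ≤ k → k ≤ K + 1 → D k ≤ 4 * maxNorm C ^ 2 := by
    intro k hk _
    by_cases hkK : k ≤ K
    · simp only [D, if_pos hkK]
      have h := integral_mono (hDi k hk hkK) (integrable_const (4 * maxNorm C ^ 2))
        fun ω => sum_norm_sub_sq_le hR (hyC k hk ω) hz
      simpa using h
    · simp only [D, if_neg hkK]
      positivity
  have hstep : ∀ k, 1 ≤ k → k ≤ K → 2 * (c / √((k + 1 : ℕ) : ℝ)) * e k ≤
      D k - D (k + 1) + (c / √((k + 1 : ℕ) : ℝ)) ^ 2 * (2 * n * (G ^ 2 + S)) := by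
    intro k hk hkK
    rcases hkK.lt_or_eq with h | h
    · have := expected_step_le hne hcl hcv hR d m α r₁ hw hS hz hk h (hα0 _)
      simpa only [D, e, if_pos hkK, if_pos (show k + 1 ≤ K from h)] using this
    -- For the fictitious step the noise is taken to be 0 and the resulting squared distance is
    -- discarded.
    · have hlast : ¬ k + 1 ≤ K := by omega
      simp only [D, e, if_pos hkK, if_neg hlast, sub_zero]
      have hpt : ∀ ω, 2 * α (k + 1) * (evCost d m (∑ i, iterate (evCost d m) C α (fun j => w j ω)
          r₁ k i) - evCost d m (∑ i, z i)) ≤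
          ∑ i, ‖iterate (evCost d m) C α (fun j => w j ω) r₁ k i - z i‖ ^ 2
            + α (k + 1) ^ 2 * (2 * n * (G ^ 2 + S)) := by
        intro ω
        have h := projected_step_le hcl hcv d m hz
          (iterate (evCost d m) C α (fun j => w j ω) r₁ k) (hα0 (k + 1)) 0
        have hG := pow_le_pow_left₀ (norm_nonneg _)
          (norm_gradient_le_maxGrad (d := d) m hR (hyC k hk ω)) 2
        have h0 := Finset.sum_nonneg fun i (_ : i ∈ Finset.univ) => sq_nonneg
          ‖proj (C i) (iterate (evCost d m) C α (fun j => w j ω) r₁ k i - α (k + 1) •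
            (gradient (evCost d m) (∑ j, iterate (evCost d m) C α (fun j => w j ω) r₁ k j) + 0))
              - z i‖
        simp only [norm_zero, inner_zero_left] at h
        have h2 : 2 * α (k + 1) ^ 2 * n * (‖gradient (evCost d m)
            (∑ i, iterate (evCost d m) C α (fun j => w j ω) r₁ k i)‖ ^ 2 + 0 ^ 2) ≤
            2 * α (k + 1) ^ 2 * n * (G ^ 2 + S) := by
          gcongr
          simpa using hS0
        linarith
      have h := integral_mono
        (((hUi k hk hkK).sub (integrable_const (evCost d m (∑ i, z i)))).const_mul (2 * α (k + 1)))
        ((hDi k hk hkK).add (integrable_const (α (k + 1) ^ 2 * (2 * n * (G ^ 2 + S))))) hpt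
      rw [integral_const_mul, integral_sub' (hUi k hk hkK) (integrable_const _),
        integral_add' (hDi k hk hkK) (integrable_const _), integral_const, integral_const,
        probReal_univ, one_smul, one_smul] at h
      exact h
  have hA : ∀ k, k < K →
      A (k + 1) ≤ (1 - weight η (k + 1)) * A k + weight η (k + 1) * e (k + 1) := by
    intro k hk
    have h := integral_mono (hAi (k + 1) hk)
      (((hAi k hk.le).const_mul (1 - weight η (k + 1))).add
        ((hUi (k + 1) (by omega) hk).const_mul (weight η (k + 1))))
      fun ω => evCost_averaged_succ_le d m C α hη (fun j => w j ω) r₁ k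
    rw [integral_add' ((hAi k hk.le).const_mul _) ((hUi (k + 1) (by omega) hk).const_mul _),
      integral_const_mul, integral_const_mul] at h
    simp only [A, e]
    linarith
  have h := averaging_bound hc hη (by positivity : 0 ≤ 2 * n * (G ^ 2 + S)) e D A hDM hstep hA
    hK le_rfl
  have hD0 : D (K + 1) = 0 := if_neg (by omega)
  rwa [hD0, sub_zero] at h

end expectation

/-! ### The rate for the chosen parameters -/

lemma noisyGrad_sq_ge (n T K : ℕ) {G L Δ ε : ℝ} (hG : 0 ≤ G) (hL : 0 ≤ L) (hΔ : 0 ≤ Δ)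
    (hε : 0 ≤ ε) :
    n * (G ^ 2 + (√2 * T * K ^ 2 * L * Δ / (2 * ε)) ^ 2) ≤ noisyGrad n T K G L Δ ε ^ 2 := by
  unfold noisyGrad
  rw [mul_pow, Real.sq_sqrt (Nat.cast_nonneg _)]
  have : 0 ≤ √2 * T * K ^ 2 * L * Δ / (2 * ε) := by positivity
  gcongr
  nlinarith

lemma weight_mul_sqrt_le {η : ℝ} (hη : 1 ≤ η) {K : ℕ} (hK : 1 ≤ K) :
    weight η K * √((K + 1 : ℕ) : ℝ) ≤ 3 * η / √(K : ℝ) := by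
  have hK' : (1 : ℝ) ≤ K := by exact_mod_cast hK
  have hs : 0 < √(K : ℝ) := Real.sqrt_pos.2 (by linarith)
  have h1 : weight η K ≤ 2 * η / K := by
    unfold weight
    gcongr <;> linarith
  have h2 : √((K + 1 : ℕ) : ℝ) ≤ 3 / 2 * √(K : ℝ) := by
    rw [Real.sqrt_le_left (by positivity), mul_pow, Real.sq_sqrt (by linarith)]
    push_cast
    linarith
  calc weight η K * √((K + 1 : ℕ) : ℝ) ≤ 2 * η / K * (3 / 2 * √(K : ℝ)) :=
        mul_le_mul h1 h2 (Real.sqrt_nonneg _) (by positivity)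
    _ = 3 * η * (√(K : ℝ) / K) := by ring
    _ = _ := by rw [Real.sqrt_div_self, ← div_eq_mul_inv]

lemma rpow_quarter_pow_four {x : ℝ} (hx : 0 ≤ x) : (x ^ (1 / 4 : ℝ)) ^ 4 = x := by
  rw [← Real.rpow_natCast, ← Real.rpow_mul hx]
  norm_num

/-- Optimizing the number of iterations in the bound `G / √K + √2 K^{3/2} q / 2`. -/
lemma le_of_optimal_iterations {η u g s A K κ : ℝ} (hη : 1 ≤ η) (hu : 0 ≤ u) (hg : 0 ≤ g)
    (hs : 0 < s) (hK : 1 ≤ K) (hκ : 0 ≤ κ) (hκ2 : κ ^ 2 * (3 * s ^ 4) = √2 * g ^ 4)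
    (hKκ : |K - κ| ≤ 1) (hA₁ : A ≤ 2 * u * g ^ 4)
    (hA₂ : A ≤ 8 * η * u * ((g ^ 4 + √2 * K ^ 2 * s ^ 4 / 2) / √K)) :
    A ≤ 40 * η * u * (g ^ 3 * s) := by
  have hr2 : √2 < 1.5 := by rw [Real.sqrt_lt' (by norm_num)]; norm_num
  have hr1 : 1.4 < √2 := by rw [Real.lt_sqrt (by norm_num)]; norm_num
  have hs4 : 0 < s ^ 4 := by positivity
  have hg4 : 0 ≤ g ^ 4 := by positivity
  have hgs : 0 ≤ u * (g ^ 3 * s) := by positivity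
  obtain ⟨hl, hr⟩ := abs_le.1 hKκ
  -- For `κ < 2` the ratio `K / κ` is uncontrolled, but `g ≤ 2 s` makes `hA₁` sufficient. For `κ ≥
  -- 2`, `κ / 2 ≤ K ≤ 3 κ / 2`, so `g` and `√K s` are comparable.
  rcases lt_or_ge κ 2 with h | h
  · have h1 : g ≤ 2 * s := by
      have : g ^ 4 ≤ (2 * s) ^ 4 := by
        have : κ ^ 2 * (3 * s ^ 4) ≤ 2 ^ 2 * (3 * s ^ 4) := by gcongr
        nlinarith
      exact le_of_pow_le_pow_left₀ (by norm_num) (by positivity) this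
    have h2 : g ^ 4 ≤ 2 * (g ^ 3 * s) := by
      calc g ^ 4 = g ^ 3 * g := by ring
        _ ≤ g ^ 3 * (2 * s) := by gcongr
        _ = _ := by ring
    have h3 : 2 * u * g ^ 4 ≤ 2 * u * (2 * (g ^ 3 * s)) := by gcongr
    nlinarith
  · have ht0 : 0 < √K := Real.sqrt_pos.2 (by linarith)
    have htK : √K ^ 2 = K := Real.sq_sqrt (by linarith)
    set t := √K
    have ht4 : (t * s) ^ 4 = K ^ 2 * s ^ 4 := by rw [← htK]; ring
    have h1 : g ≤ 2 * (t * s) := by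
      have : g ^ 4 ≤ (2 * (t * s)) ^ 4 := by
        rw [mul_pow, ht4]
        have : κ ^ 2 * (3 * s ^ 4) ≤ (2 * K) ^ 2 * (3 * s ^ 4) := by gcongr; linarith
        nlinarith
      exact le_of_pow_le_pow_left₀ (by norm_num) (by positivity) this
    have h2 : t * s ≤ 3 / 2 * g := by
      have : (t * s) ^ 4 ≤ (3 / 2 * g) ^ 4 := by
        rw [ht4, mul_pow]
        have : K ^ 2 * (3 * s ^ 4) ≤ (3 / 2 * κ) ^ 2 * (3 * s ^ 4) := by gcongr; linarith
        nlinarith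
      exact le_of_pow_le_pow_left₀ (by norm_num) (by positivity) this
    have h3 : g ^ 4 / t ≤ 2 * (g ^ 3 * s) := by
      rw [div_le_iff₀ ht0]
      calc g ^ 4 = g ^ 3 * g := by ring
        _ ≤ g ^ 3 * (2 * (t * s)) := by gcongr
        _ = _ := by ring
    have h4 : √2 * K ^ 2 * s ^ 4 / 2 / t ≤ 3 * (g ^ 3 * s) := by
      have e : √2 * K ^ 2 * s ^ 4 / 2 / t = √2 / 2 * s * (t * s) ^ 3 := by
        rw [mul_assoc √2, ← ht4]
        field_simp
      rw [e]
      calc √2 / 2 * s * (t * s) ^ 3 ≤ 1.5 / 2 * s * (3 / 2 * g) ^ 3 := by gcongr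
        _ = 81 / 32 * (g ^ 3 * s) := by ring
        _ ≤ _ := by gcongr; norm_num
    have h5 : (g ^ 4 + √2 * K ^ 2 * s ^ 4 / 2) / t ≤ 5 * (g ^ 3 * s) := by
      rw [add_div]
      linarith
    calc A ≤ _ := hA₂
      _ ≤ 8 * η * u * (5 * (g ^ 3 * s)) := by gcongr
      _ = _ := by ring

/-- In dimension 0 all projections coincide. Positivity of `T` is needed for the moments of the
noise. -/
lemma dimension_pos_of_projSensitivity_pos {T : ℕ} {δr δE : ℝ}
    (h : 0 < projSensitivity T δr δE) : 0 < T := by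
  rcases T.eq_zero_or_pos with rfl | hT
  · refine absurd h (not_lt.2 (Real.sSup_nonpos ?_))
    rintro _ ⟨_, _, _, _, r, _, _, _, _, rfl⟩
    rw [Subsingleton.elim (proj _ r) (proj _ r), sub_self, norm_zero]
  · exact hT

lemma IsNoise.moments {T K : ℕ} {Ω : Type*} [MeasurableSpace Ω] {P : Measure Ω}
    [IsProbabilityMeasure P] {w : ℕ → Ω → Vec T} {L Δ ε : ℝ} (hw : IsNoise P K L Δ ε w)
    (hT : 0 < T) (hL : 0 < L) (hΔ : 0 < Δ) (hε : 0 < ε) {k : ℕ} (hk : 2 ≤ k) (hkK : k ≤ K) :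
    Integrable (w k) P ∧ Integrable (fun ω => ‖w k ω‖ ^ 2) P ∧
      ∫ ω, ‖w k ω‖ ^ 2 ∂P ≤ (√2 * T * K ^ 2 * L * Δ / (2 * ε)) ^ 2 ∧ ∫ ω, w k ω ∂P = 0 := by
  have hlaw := hw.law k hk hkK
  have hK : (2 : ℝ) ≤ K := by exact_mod_cast hk.trans hkK
  have ha : 0 < 2 * ε / ((K : ℝ) * ((K : ℝ) - 1) * L * Δ) := by
    have : (0 : ℝ) < K - 1 := by linarith
    positivity
  refine ⟨integrable_of_hasLaw hT ha hlaw, integrable_norm_sq_of_hasLaw hT ha hlaw, ?_,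
    integral_eq_zero_of_hasLaw hT ha hlaw⟩
  rw [integral_norm_sq_of_hasLaw hT ha hlaw]
  exact noise_second_moment_le hT (hk.trans hkK) hε hL hΔ

/-- The step constant `ρ / Ĝ` balances the distance term, of order `ρ² / c`, against the gradient
term, of order `c Ĝ²`; they contribute 6 and 2 to the constant 8. -/
lemma expected_averaged_sub_le_noisyGrad {n T : ℕ} {C : Fin n → Set (Vec T)}
    (hne : ∀ i, (C i).Nonempty) (hcl : ∀ i, IsClosed (C i)) (hcv : ∀ i, Convex ℝ (C i))
    {R : ℝ} (hR : ∀ i, ∀ r ∈ C i, ‖r‖ ≤ R) (d : Vec T) (m : ℕ) (r₁ : Fin n → Vec T)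
    {Ω : Type*} [MeasurableSpace Ω] {P : Measure Ω} [IsProbabilityMeasure P] {w : ℕ → Ω → Vec T}
    {K : ℕ} {L Δ ε : ℝ} (hw : IsNoise P K L Δ ε w) (hn : 0 < n) (hT : 0 < T) (hL : 0 < L)
    (hΔ : 0 < Δ) (hε : 0 < ε) (hK : 1 ≤ K) {η : ℝ} (hη : 1 ≤ η) (hρ : 0 < maxNorm C)
    {z : Fin n → Vec T} (hz : z ∈ feasible C) :
    ∫ ω, evCost d m (∑ i, averaged (evCost d m) C
        (fun k => maxNorm C / noisyGrad n T K (maxGrad (evCost d m) C) L Δ ε / √(k : ℝ)) η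
        (fun j => w j ω) r₁ K i) ∂P - evCost d m (∑ i, z i) ≤
      8 * η * (maxNorm C * noisyGrad n T K (maxGrad (evCost d m) C) L Δ ε / √(K : ℝ)) := by
  have hG := maxGrad_nonneg (evCost d m) C
  have hsq := noisyGrad_sq_ge n T K hG hL.le hΔ.le hε.le
  have hΓ : 0 < noisyGrad n T K (maxGrad (evCost d m) C) L Δ ε := by
    unfold noisyGrad
    have h1 : (0 : ℝ) < n := by exact_mod_cast hn
    have h2 : (0 : ℝ) < T := by exact_mod_cast hT
    have h3 : (0 : ℝ) < K := by exact_mod_cast hK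
    positivity
  have h := expected_averaged_sub_le hne hcl hcv hR d m r₁ hw (sq_nonneg _)
    (fun k hk hkK => hw.moments hT hL hΔ hε hk hkK) hz hK (div_pos hρ hΓ) hη
  refine h.trans ?_
  set Γ := noisyGrad n T K (maxGrad (evCost d m) C) L Δ ε
  set ρ := maxNorm C
  have hs : 0 < √(K : ℝ) := Real.sqrt_pos.2 (by exact_mod_cast hK)
  have h1 : weight η K * √((K + 1 : ℕ) : ℝ) / (2 * (ρ / Γ)) * (4 * ρ ^ 2) ≤
      6 * η * (ρ * Γ / √(K : ℝ)) := by
    calc _ = weight η K * √((K + 1 : ℕ) : ℝ) * (2 * ρ * Γ) := by field_simp; norm_num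
      _ ≤ 3 * η / √(K : ℝ) * (2 * ρ * Γ) := by
        gcongr
        exact weight_mul_sqrt_le hη hK
      _ = _ := by ring
  have h2 : ρ / Γ * (2 * n * (maxGrad (evCost d m) C ^ 2 +
      (√2 * T * K ^ 2 * L * Δ / (2 * ε)) ^ 2)) / √(K : ℝ) ≤ 2 * η * (ρ * Γ / √(K : ℝ)) := by
    calc _ = ρ / Γ * (2 * (n * (maxGrad (evCost d m) C ^ 2 +
      (√2 * T * K ^ 2 * L * Δ / (2 * ε)) ^ 2))) / √(K : ℝ) := by ring
      _ ≤ ρ / Γ * (2 * Γ ^ 2) / √(K : ℝ) := by gcongr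
      _ = 2 * 1 * (ρ * Γ / √(K : ℝ)) := by field_simp
      _ ≤ _ := by gcongr
  linarith

/-- The bound for a fixed competitor, in terms of `G` and `q = T L Δ / ε`. -/
lemma expected_averaged_sub_le_rpow {n T : ℕ} {C : Fin n → Set (Vec T)}
    (hne : ∀ i, (C i).Nonempty) (hcl : ∀ i, IsClosed (C i)) (hcv : ∀ i, Convex ℝ (C i))
    {R : ℝ} (hR : ∀ i, ∀ r ∈ C i, ‖r‖ ≤ R) (d : Vec T) (m : ℕ) (r₁ : Fin n → Vec T)
    {Ω : Type*} [MeasurableSpace Ω] {P : Measure Ω} [IsProbabilityMeasure P] {w : ℕ → Ω → Vec T}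
    {K : ℕ} {L Δ ε : ℝ} (hw : IsNoise P K L Δ ε w) (hn : 0 < n) (hT : 0 < T) (hL : 0 < L)
    (hΔ : 0 < Δ) (hε : 0 < ε) (hK : 1 ≤ K) {η : ℝ} (hη : 1 ≤ η)
    (hKopt : |(K : ℝ) - optIter T (maxGrad (evCost d m) C) L Δ ε| ≤ 1)
    {z : Fin n → Vec T} (hz : z ∈ feasible C) :
    ∫ ω, evCost d m (∑ i, averaged (evCost d m) C
        (fun k => maxNorm C / noisyGrad n T K (maxGrad (evCost d m) C) L Δ ε / √(k : ℝ)) η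
        (fun j => w j ω) r₁ K i) ∂P - evCost d m (∑ i, z i) ≤
      40 * η * (√n * maxNorm C) *
        ((maxGrad (evCost d m) C ^ (1 / 4 : ℝ)) ^ 3 * (T * L * Δ / ε) ^ (1 / 4 : ℝ)) := by
  have hG := maxGrad_nonneg (evCost d m) C
  have hρ := maxNorm_nonneg C
  have hT' : (0 : ℝ) < T := by exact_mod_cast hT
  have hK' : (1 : ℝ) ≤ K := by exact_mod_cast hK
  have hq : 0 < T * L * Δ / ε := by positivity
  have hg4 := rpow_quarter_pow_four hG
  have hs4 := rpow_quarter_pow_four hq.le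
  set α : ℕ → ℝ :=
    fun k => maxNorm C / noisyGrad n T K (maxGrad (evCost d m) C) L Δ ε / √(k : ℝ) with hα
  have hAi := integrable_comp_averaged hne hcl hcv hR d m α r₁ hw hη le_rfl
    (f := fun x => evCost d m (∑ i, x i)) ((continuous_evCost d m).comp (by fun_prop))
  have htriv : ∫ ω, evCost d m (∑ i, averaged (evCost d m) C α η (fun j => w j ω) r₁ K i) ∂P
      - evCost d m (∑ i, z i) ≤ 2 * (√n * maxNorm C) * maxGrad (evCost d m) C := by
    have h := integral_mono hAi (integrable_const (evCost d m (∑ i, z i) +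
      2 * √n * maxNorm C * maxGrad (evCost d m) C)) fun ω => by
        obtain ⟨k, hk⟩ : ∃ k, K = k + 1 := ⟨K - 1, by omega⟩
        have hmem : averaged (evCost d m) C α η (fun j => w j ω) r₁ K ∈ feasible C := by
          rw [hk]
          exact averaged_succ_mem _ hne hcl hcv _ hη _ _ _
        have := evCost_sub_le_maxGrad d m hR hmem hz
        simp only
        linarith
    rw [integral_const, probReal_univ, one_smul] at h
    linarith
  -- If `ρ = 0` all step sizes vanish and the descent estimate does not apply, but the a priori
  -- bound is then 0.
  rcases hρ.eq_or_lt with h0 | hρ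
  · rw [← h0] at htriv ⊢
    simpa using htriv
  refine le_of_optimal_iterations hη (by positivity) (by positivity) (Real.rpow_pos_of_pos hq _)
    hK' (Real.sqrt_nonneg _) ?_ hKopt (by rwa [hg4]) ?_
  · rw [hg4, hs4, Real.sq_sqrt (by positivity)]
    field_simp
  · rw [hg4, hs4]
    refine (expected_averaged_sub_le_noisyGrad hne hcl hcv hR d m r₁ hw hn hT hL hΔ hε hK hη hρ
      hz).trans_eq ?_
    unfold noisyGrad
    field_simp

end PrivateDCO

open PrivateDCO in
theorem mainTheorem4 (γ R D : ℝ) (hγ : 0 < γ) :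
    ∃ B : ℝ, 0 < B ∧
      ∀ (n m T : ℕ), 0 < n → 0 < m → (n : ℝ) / (m : ℝ) = γ →
      -- the base load and the charging specifications
      ∀ (d : PrivateDCO.Vec T) (rbar : Fin n → PrivateDCO.Vec T) (E : Fin n → ℝ)
        (C : Fin n → Set (PrivateDCO.Vec T)) (U : PrivateDCO.Vec T → ℝ),
        ‖d‖ ≤ D →
        (∀ i, PrivateDCO.IsSpec (rbar i) (E i)) →
        (∀ i, C i = PrivateDCO.chargingSet (rbar i) (E i)) →
        (∀ i, ∀ r ∈ C i, ‖r‖ ≤ R) →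
        U = PrivateDCO.evCost d m →
      -- the constants of the problem
      ∀ (δr δE ε η Δ L ρ G : ℝ),
        Δ = PrivateDCO.projSensitivity T δr δE → 0 < Δ → 0 < ε → 1 ≤ η →
        L = 1 / (m : ℝ) ^ 2 →
        ρ = PrivateDCO.maxNorm C →
        G = PrivateDCO.maxGrad U C →
      -- the number of iterations, the step sizes, and the initial point
      ∀ (K : ℕ) (c : ℝ) (r₁ : Fin n → PrivateDCO.Vec T),
        1 ≤ K → |(K : ℝ) - PrivateDCO.optIter T G L Δ ε| ≤ 1 →
        c = ρ / PrivateDCO.noisyGrad n T K G L Δ ε →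
      -- the noise
      ∀ (Ω : Type*) [MeasurableSpace Ω] (P : MeasureTheory.Measure Ω)
        [MeasureTheory.IsProbabilityMeasure P] (w : ℕ → Ω → PrivateDCO.Vec T),
        PrivateDCO.IsNoise P K L Δ ε w →
        MeasureTheory.Integrable (fun ω =>
          U (∑ i, PrivateDCO.averaged U C (fun k => c / √(k : ℝ)) η (fun k => w k ω) r₁ K i)
            - PrivateDCO.optValue U C) P ∧
        ∫ ω, (U (∑ i, PrivateDCO.averaged U C (fun k => c / √(k : ℝ)) η (fun k => w k ω) r₁ K i)
            - PrivateDCO.optValue U C) ∂P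
          ≤ B * (η * (T : ℝ) ^ (1 / 4 : ℝ) * (Δ / ((n : ℝ) * ε)) ^ (1 / 4 : ℝ)) := by
  -- The summand 1 only secures strict positivity, for instance when `R = 0`.
  refine ⟨40 * |R| * ((|D| + γ * |R|) ^ 3 * γ ^ 5) ^ (1 / 4 : ℝ) + 1, by positivity, ?_⟩
  intro n m T hn hm hnm d rbar E C U hd hspec hC hR hU δr δE ε η Δ L ρ G hΔs hΔ hε hη hL hρ hG
    K c r₁ hK hKopt hc Ω _ P _ w hw
  subst hU hρ hG hc
  have hT : 0 < T := dimension_pos_of_projSensitivity_pos (hΔs ▸ hΔ)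
  have hn' : (0 : ℝ) < n := by exact_mod_cast hn
  have hm' : (0 : ℝ) < m := by exact_mod_cast hm
  have hT' : (0 : ℝ) < T := by exact_mod_cast hT
  have hL0 : 0 < L := by rw [hL]; positivity
  have hne : ∀ i, (C i).Nonempty := fun i => by
    rw [hC]
    exact chargingSet_nonempty (hspec i)
  have hcl : ∀ i, IsClosed (C i) := fun i => by
    rw [hC]
    exact isClosed_chargingSet _ _
  have hcv : ∀ i, Convex ℝ (C i) := fun i => by
    rw [hC]
    exact convex_chargingSet _ _
  set α : ℕ → ℝ :=
    fun k => maxNorm C / noisyGrad n T K (maxGrad (evCost d m) C) L Δ ε / √(k : ℝ) with hα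
  have hAi : Integrable (fun ω => evCost d m (∑ i, averaged (evCost d m) C α η
      (fun k => w k ω) r₁ K i)) P :=
    integrable_comp_averaged hne hcl hcv hR d m α r₁ hw hη le_rfl
      (f := fun x => evCost d m (∑ i, x i)) ((continuous_evCost d m).comp (by fun_prop))
  refine ⟨hAi.sub (integrable_const _), ?_⟩
  rw [integral_sub hAi (integrable_const _), integral_const, probReal_univ, one_smul]
  have hbound : 40 * η * (√n * maxNorm C) * ((maxGrad (evCost d m) C ^ (1 / 4 : ℝ)) ^ 3 *
      (T * L * Δ / ε) ^ (1 / 4 : ℝ)) ≤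
      (40 * |R| * ((|D| + γ * |R|) ^ 3 * γ ^ 5) ^ (1 / 4 : ℝ) + 1) *
        (η * (T : ℝ) ^ (1 / 4 : ℝ) * (Δ / ((n : ℝ) * ε)) ^ (1 / 4 : ℝ)) := by
    have hG0 := maxGrad_nonneg (evCost d m) C
    have hGle : maxGrad (evCost d m) C ≤ 1 / m * (|D| + γ * |R|) := by
      rw [← hnm]
      exact maxGrad_le m (hd.trans (le_abs_self D)) hR
    have hρle : √n * maxNorm C ≤ n * |R| := by
      calc √n * maxNorm C ≤ √n * (√n * |R|) := by gcongr; exact maxNorm_le hR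
        _ = √n * √n * |R| := by ring
        _ = _ := by rw [Real.mul_self_sqrt hn'.le]
    set W := |D| + γ * |R|
    have hW0 : 0 ≤ W := by positivity
    have hkey : n * ((maxGrad (evCost d m) C ^ (1 / 4 : ℝ)) ^ 3 *
        (T * L * Δ / ε) ^ (1 / 4 : ℝ)) ≤ (W ^ 3 * γ ^ 5) ^ (1 / 4 : ℝ) *
        ((T : ℝ) ^ (1 / 4 : ℝ) * (Δ / ((n : ℝ) * ε)) ^ (1 / 4 : ℝ)) := by
      -- After taking fourth powers, `n⁴` meets `m⁻³` from `G³` and `m⁻²` from `L`; the product is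
      -- `γ⁵ / n`.
      refine le_of_pow_le_pow_left₀ (n := 4) (by norm_num) (by positivity) ?_
      rw [mul_pow, mul_pow, mul_pow, mul_pow, pow_right_comm _ 3 4, rpow_quarter_pow_four hG0,
        rpow_quarter_pow_four (by positivity), rpow_quarter_pow_four (by positivity),
        rpow_quarter_pow_four hT'.le, rpow_quarter_pow_four (by positivity)]
      calc (n : ℝ) ^ 4 * (maxGrad (evCost d m) C ^ 3 * (T * L * Δ / ε))
          ≤ n ^ 4 * ((1 / m * W) ^ 3 * (T * L * Δ / ε)) := by gcongr
        _ = W ^ 3 * γ ^ 5 * (T * (Δ / (n * ε))) := by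
          rw [hL, ← hnm]
          field_simp
    have hrest : 0 ≤ η * (T : ℝ) ^ (1 / 4 : ℝ) * (Δ / ((n : ℝ) * ε)) ^ (1 / 4 : ℝ) := by
      positivity
    calc _ ≤ 40 * η * (n * |R|) * ((maxGrad (evCost d m) C ^ (1 / 4 : ℝ)) ^ 3 *
          (T * L * Δ / ε) ^ (1 / 4 : ℝ)) := by gcongr
      _ = 40 * η * |R| * (n * ((maxGrad (evCost d m) C ^ (1 / 4 : ℝ)) ^ 3 *
          (T * L * Δ / ε) ^ (1 / 4 : ℝ))) := by ring
      _ ≤ 40 * η * |R| * ((W ^ 3 * γ ^ 5) ^ (1 / 4 : ℝ) *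
          ((T : ℝ) ^ (1 / 4 : ℝ) * (Δ / ((n : ℝ) * ε)) ^ (1 / 4 : ℝ))) := by gcongr
      _ = 40 * |R| * (W ^ 3 * γ ^ 5) ^ (1 / 4 : ℝ) *
          (η * (T : ℝ) ^ (1 / 4 : ℝ) * (Δ / ((n : ℝ) * ε)) ^ (1 / 4 : ℝ)) := by ring
      _ ≤ _ := by gcongr; linarith
  refine le_trans ?_ hbound
  -- With `U*` alone on the right, it suffices to bound its value at each feasible competitor from
  -- below, so no minimizer is needed.
  rw [sub_le_comm]
  refine le_csInf ?_ ?_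
  · choose x hx using hne
    exact ⟨_, x, hx, rfl⟩
  · rintro _ ⟨z, hz, rfl⟩
    have h := expected_averaged_sub_le_rpow hne hcl hcv hR d m r₁ hw hn hT hL0 hΔ hε hK hη hKopt hz
    simp only
    linarith
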